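/- Let $R$ be a commutative unital ring, $t\in R$, and $\sigma:R\to R$ a unital ring endomorphism which is *essential*: for every maximal ideal $\mathbf m$ of $R$ the canonical inclusion $\sigma(R)/(\sigma(R)\cap\mathbf m)\hookrightarrow R/\mathbf m$ is surjective. Let $A=A(R,\sigma,t)$ be the rank-one weak generalized Weyl algebra, i.e. the ring generated over $R$ by $X,Y$ with relations $YX=t$, $XY=\sigma(t)$, $Xr=\sigma(r)X$, $rY=Y\sigma(r)$ for all $r\in R$. A left $A$-module $V$ is a *weight module* if $V=\bigoplus_{\mathbf m}V_{\mathbf m}$, where $\mathbf m$ runs over all maximal ideals of $R$ and $V_{\mathbf m}=\{v\in V:\mathbf m v=0\}$. *String modules.* Let $S$ be one of $\{0,1,\dots,n\}$ ($n\ge 0$), $\{0,1,2,\dots\}$, $\{0,-1,-2,\dots\}$, $\mathbb Z$, and let $(\mathbf m_i)_{i\in S}$ be maximal ideals of $R$ with $\sigma(\mathbf m_i)\subset\mathbf m_{i+1}$ whenever $i,i+1\in S$, with $\sigma(t)\in\mathbf m_i$ if $i$ is the smallest element of $S$, and with $t\in\mathbf m_i$ if $i$ is the largest element of $S$. The corresponding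 string module (bounded, right infinite, left infinite, doubly infinite, respectively) is $\bigoplus_{i\in S}R/\mathbf m_i$ with its natural $R$-module structure, where $X$ sends $r+\mathbf m_i$ to $\sigma(tr)+\mathbf m_{i+1}$ if $i+1\in S$ and to $0$ otherwise, and $Y$ sends $r+\mathbf m_i$ to $s+\mathbf m_{i-1}$, for any $s\in R$ with $\sigma(s)\in r+\mathbf m_i$, if $i-1\in S$ and to $0$ otherwise. *Band modules.* Let $(\mathbf m_i)_{i\in\mathbb Z}$ be maximal ideals of $R$ with $\sigma(\mathbf m_i)\subset\mathbf m_{i+1}$ for all $i$, periodic with minimal period $k\ge 1$. Put $\Bbbk=R/\mathbf m_0$, let $\tau_l:R/\mathbf m_a\to R/\mathbf m_{a+l}$ ($a\in\mathbb Z$, $l\ge 0$) be the isomorphism $r+\mathbf m_a\mapsto\sigma^l(r)+\mathbf m_{a+l}$, and let $\overline\sigma=\tau_k:\Bbbk\to R/\mathbf m_k=\Bbbk$. Let $\mathbf P=\Bbbk[\alpha,\alpha^{-1};\overline\sigma]$ be the skew Laurent polynomial ring, with $\alpha c=\overline\sigma(c)\alpha$ for $c\in\Bbbk$, let $f\in\mathbf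 P$ be irreducible and $L_f=\mathbf P/\mathbf P f$. - $M^f=\bigoplus_{i=0}^{k-1}M^f_{\mathbf m_{-i}}$ with $M^f_{\mathbf m_{-i}}=L_f$ as a group, on which $r\in R$ acts as $\tau_i(r+\mathbf m_{-i})\in\Bbbk$; $Y:M^f_{\mathbf m_{-i}}\to M^f_{\mathbf m_{-i-1}}$ is the identity of $L_f$ for $0\le i\le k-2$, $Y:M^f_{\mathbf m_{-(k-1)}}\to M^f_{\mathbf m_0}$ is the action of $\alpha^{-1}$, and $X(Yv)=\sigma(t)v$ (as $Y$ is bijective, this determines $X$). - $N^f=\bigoplus_{i=0}^{k-1}N^f_{\mathbf m_i}$ with $N^f_{\mathbf m_i}=L_f$ as a group, on which $r\in R$ acts as $\tau_i^{-1}(r+\mathbf m_i)\in\Bbbk$; $X:N^f_{\mathbf m_i}\to N^f_{\mathbf m_{i+1}}$ is the identity of $L_f$ for $0\le i\le k-2$, $X:N^f_{\mathbf m_{k-1}}\to N^f_{\mathbf m_0}$ is the action of $\alpha$, and $Y(Xv)=tv$ (as $X$ is bijective, this determines $Y$). The band modules are the modules $M^f$ and $N^f$. **Theorem.** Every simple weight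 $A$-module is isomorphic to a string module or to a band module. -/

import Mathlib

open scoped DirectSum

universe u v

/-! ## Rank one weak generalized Weyl algebras -/

/-- Generators of `A(R, σ, t)`: the elements of `R` together with `X` and `Y`. -/
inductive WGWAGen (R : Type u) : Type u
  | coeff (r : R) : WGWAGen R
  | X : WGWAGen R
  | Y : WGWAGen R

section Algebra

variable {R : Type u} [CommRing R]

/-- Defining relations of `A(R, σ, t)`: `R` maps in by a ring homomorphism, and
`YX = t`, `XY = σ(t)`, `X r = σ(r) X`, `r Y = Y σ(r)`. -/
inductive WGWARel (σ : R →+* R) (t : R) :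
    FreeAlgebra ℤ (WGWAGen R) → FreeAlgebra ℤ (WGWAGen R) → Prop
  | one : WGWARel σ t (FreeAlgebra.ι ℤ (.coeff 1)) 1
  | add (r s : R) : WGWARel σ t (FreeAlgebra.ι ℤ (.coeff (r + s)))
      (FreeAlgebra.ι ℤ (.coeff r) + FreeAlgebra.ι ℤ (.coeff s))
  | mul (r s : R) : WGWARel σ t (FreeAlgebra.ι ℤ (.coeff (r * s)))
      (FreeAlgebra.ι ℤ (.coeff r) * FreeAlgebra.ι ℤ (.coeff s))
  | yx : WGWARel σ t (FreeAlgebra.ι ℤ .Y * FreeAlgebra.ι ℤ .X) (FreeAlgebra.ι ℤ (.coeff t))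
  | xy : WGWARel σ t (FreeAlgebra.ι ℤ .X * FreeAlgebra.ι ℤ .Y) (FreeAlgebra.ι ℤ (.coeff (σ t)))
  | xr (r : R) : WGWARel σ t (FreeAlgebra.ι ℤ .X * FreeAlgebra.ι ℤ (.coeff r))
      (FreeAlgebra.ι ℤ (.coeff (σ r)) * FreeAlgebra.ι ℤ .X)
  | ry (r : R) : WGWARel σ t (FreeAlgebra.ι ℤ (.coeff r) * FreeAlgebra.ι ℤ .Y)
      (FreeAlgebra.ι ℤ .Y * FreeAlgebra.ι ℤ (.coeff (σ r)))

/-- The rank one weak generalized Weyl algebra `A(R, σ, t)`. -/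
def WGWA (σ : R →+* R) (t : R) : Type u := RingQuot (WGWARel σ t)

noncomputable instance (σ : R →+* R) (t : R) : Ring (WGWA σ t) :=
  inferInstanceAs (Ring (RingQuot (WGWARel σ t)))

namespace WGWA

variable (σ : R →+* R) (t : R)

/-- The quotient map from the free ring onto `A(R, σ, t)`. -/
noncomputable def mk : FreeAlgebra ℤ (WGWAGen R) →+* WGWA σ t :=
  RingQuot.mkRingHom (WGWARel σ t)

theorem mk_rel {a b : FreeAlgebra ℤ (WGWAGen R)} (h : WGWARel σ t a b) : mk σ t a = mk σ t b :=
  RingQuot.mkRingHom_rel h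

/-- The structure homomorphism `R → A(R, σ, t)`. -/
noncomputable def coeff : R →+* WGWA σ t :=
  RingHom.mk'
    { toFun := fun r => mk σ t (FreeAlgebra.ι ℤ (.coeff r))
      map_one' := by rw [mk_rel σ t .one, map_one]
      map_mul' := fun r s => by rw [mk_rel σ t (.mul r s), map_mul] }
    (fun r s => by
      change mk σ t (FreeAlgebra.ι ℤ (.coeff (r + s))) = _
      rw [mk_rel σ t (.add r s), map_add]; rfl)

/-- The generator `X`. -/
noncomputable def X : WGWA σ t := mk σ t (FreeAlgebra.ι ℤ .X)

/-- The generator `Y`. -/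
noncomputable def Y : WGWA σ t := mk σ t (FreeAlgebra.ι ℤ .Y)

/-- Universal property of `A(R, σ, t)`. -/
noncomputable def lift {σ : R →+* R} {t : R} {B : Type v} [Ring B] (ρ : R →+* B) (x y : B)
    (hyx : y * x = ρ t) (hxy : x * y = ρ (σ t)) (hxr : ∀ r, x * ρ r = ρ (σ r) * x)
    (hry : ∀ r, ρ r * y = y * ρ (σ r)) : WGWA σ t →+* B :=
  RingQuot.lift
    ⟨(FreeAlgebra.lift ℤ (fun g : WGWAGen R => match g with
        | .coeff r => ρ r
        | .X => x
        | .Y => y)).toRingHom, by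
      intro a b h
      cases h <;> simp [hyx, hxy, hxr, hry]⟩

section lift

variable {σ t} {B : Type v} [Ring B] (ρ : R →+* B) (x y : B)
    (hyx : y * x = ρ t) (hxy : x * y = ρ (σ t)) (hxr : ∀ r, x * ρ r = ρ (σ r) * x)
    (hry : ∀ r, ρ r * y = y * ρ (σ r))

theorem lift_coeff (r : R) : lift ρ x y hyx hxy hxr hry (coeff σ t r) = ρ r :=
  (RingQuot.lift_mkRingHom_apply _ _ _).trans (by simp)

theorem lift_X : lift ρ x y hyx hxy hxr hry (X σ t) = x :=
  (RingQuot.lift_mkRingHom_apply _ _ _).trans (by simp)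

theorem lift_Y : lift ρ x y hyx hxy hxr hry (Y σ t) = y :=
  (RingQuot.lift_mkRingHom_apply _ _ _).trans (by simp)

end lift

end WGWA

/-! ## Weight modules -/

section Weight

variable (σ : R →+* R) (t : R) (V : Type v) [AddCommGroup V] [Module (WGWA σ t) V]

/-- The weight space `V_m = {v ∈ V | m v = 0}`. -/
def weightSpace (m : MaximalSpectrum R) : AddSubgroup V where
  carrier := {w | ∀ r ∈ m.asIdeal, WGWA.coeff σ t r • w = 0}
  zero_mem' := fun r _ => smul_zero _
  add_mem' := fun ha hb r hr => by rw [smul_add, ha r hr, hb r hr, add_zero]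
  neg_mem' := fun ha r hr => by rw [smul_neg, ha r hr, neg_zero]

open Classical in
/-- `V` is a weight module: `V` is the internal direct sum of the weight spaces `V_m`, where `m`
runs over all maximal ideals of `R`. -/
def IsWeightModule : Prop :=
  DirectSum.IsInternal (fun m : MaximalSpectrum R => weightSpace σ t V m)

end Weight

/-! ## Essential endomorphisms and the induced maps of residue fields -/

/-- `σ` is essential: for every maximal ideal `m` of `R` the canonical inclusion
`σ(R) / (σ(R) ∩ m) → R / m` is surjective. -/
def IsEssential (σ : R →+* R) : Prop :=
  ∀ m : MaximalSpectrum R, Function.Surjective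
    (Ideal.quotientMap m.asIdeal σ.range.subtype le_rfl :
      σ.range ⧸ m.asIdeal.comap σ.range.subtype →+* R ⧸ m.asIdeal)

theorem IsEssential.exists_sub_mem {σ : R →+* R} (hσ : IsEssential σ) (m : MaximalSpectrum R)
    (r : R) : ∃ s, σ s - r ∈ m.asIdeal := by
  obtain ⟨x, hx⟩ := hσ m (Ideal.Quotient.mk _ r)
  obtain ⟨⟨_, s, rfl⟩, rfl⟩ := Ideal.Quotient.mk_surjective x
  rw [Ideal.quotientMap_mk] at hx
  exact ⟨s, Ideal.Quotient.eq.1 hx⟩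

/-- The isomorphism of residue fields `R / p ≃ R / q`, `r + p ↦ φ(r) + q`, induced by a ring
endomorphism `φ` with `φ(p) ⊆ q` and `φ(R) + q = R`. -/
noncomputable def residueEquiv (φ : R →+* R) (p q : MaximalSpectrum R)
    (h : p.asIdeal ≤ q.asIdeal.comap φ) (hs : ∀ r, ∃ s, φ s - r ∈ q.asIdeal) :
    R ⧸ p.asIdeal ≃+* R ⧸ q.asIdeal :=
  RingEquiv.ofBijective (Ideal.quotientMap q.asIdeal φ h) <| by
    constructor
    · apply Ideal.quotientMap_injective'
      exact (p.isMaximal.eq_of_le (Ideal.comap_ne_top φ q.isMaximal.ne_top) h).ge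
    · intro y
      obtain ⟨r, rfl⟩ := Ideal.Quotient.mk_surjective y
      obtain ⟨s, hsr⟩ := hs r
      exact ⟨Ideal.Quotient.mk _ s, by
        rw [Ideal.quotientMap_mk]; exact Ideal.Quotient.eq.2 hsr⟩

theorem residueEquiv_mk (φ : R →+* R) (p q : MaximalSpectrum R)
    (h : p.asIdeal ≤ q.asIdeal.comap φ) (hs : ∀ r, ∃ s, φ s - r ∈ q.asIdeal) (r : R) :
    residueEquiv φ p q h hs (Ideal.Quotient.mk _ r) = Ideal.Quotient.mk _ (φ r) := by
  change Ideal.quotientMap q.asIdeal φ h (Ideal.Quotient.mk _ r) = _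
  rw [Ideal.quotientMap_mk]

theorem end_mul_apply {N : Type v} [AddCommGroup N] (f g : AddMonoid.End N) (x : N) :
    (f * g) x = f (g x) := rfl

/-! ## String modules -/

/-- A chain of maximal ideals `(m_i)`, `i ∈ S`, indexed by an interval `S` of integers, such that
`σ(m_i) ⊆ m_{i+1}` whenever `i, i + 1 ∈ S`, with `σ(t) ∈ m_i` if `i` is the left end of `S` and
`t ∈ m_i` if `i` is the right end of `S`.  For `S = ℤ`, `S = {0, 1, 2, …}`,
`S = {0, -1, -2, …}` and `S = {0, 1, …, n}` these are the index sets of the doubly infinite,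
right infinite, left infinite and bounded string modules, respectively. -/
structure StringChain (σ : R →+* R) (t : R) (S : Set ℤ) where
  ideal : S → MaximalSpectrum R
  step : ∀ i j : S, (j : ℤ) = i + 1 → (ideal i).asIdeal ≤ (ideal j).asIdeal.comap σ
  left_end : ∀ i : S, (i : ℤ) - 1 ∉ S → σ t ∈ (ideal i).asIdeal
  right_end : ∀ i : S, (i : ℤ) + 1 ∉ S → t ∈ (ideal i).asIdeal

/-- The underlying abelian group `⨁_{i ∈ S} R / m_i` of the string module attached to a chain. -/
def StringModule {σ : R →+* R} {t : R} (_hσ : IsEssential σ) {S : Set ℤ}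
    (m : StringChain σ t S) : Type u :=
  ⨁ i : S, R ⧸ (m.ideal i).asIdeal

namespace StringModule

variable {σ : R →+* R} {t : R} (hσ : IsEssential σ) {S : Set ℤ} (m : StringChain σ t S)

noncomputable instance : AddCommGroup (StringModule hσ m) :=
  inferInstanceAs (AddCommGroup (⨁ i : S, R ⧸ (m.ideal i).asIdeal))

open Classical in
/-- The inclusion of the summand `R / m_i`. -/
noncomputable def of (i : S) : R ⧸ (m.ideal i).asIdeal →+ StringModule hσ m :=
  DirectSum.of (fun i : S => R ⧸ (m.ideal i).asIdeal) i

theorem end_ext {f g : AddMonoid.End (StringModule hσ m)}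
    (h : ∀ (i : S) (r : R), f (of hσ m i (Ideal.Quotient.mk _ r)) =
      g (of hσ m i (Ideal.Quotient.mk _ r))) : f = g := by
  classical
  refine DirectSum.addHom_ext (fun i y => ?_)
  obtain ⟨r, rfl⟩ := Ideal.Quotient.mk_surjective y
  exact h i r

open Classical in
/-- An additive endomorphism given on each summand. -/
noncomputable def desc (f : ∀ i : S, R ⧸ (m.ideal i).asIdeal →+ StringModule hσ m) :
    AddMonoid.End (StringModule hσ m) :=
  DirectSum.toAddMonoid f

theorem desc_of (f : ∀ i : S, R ⧸ (m.ideal i).asIdeal →+ StringModule hσ m) (i : S)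
    (y : R ⧸ (m.ideal i).asIdeal) : desc hσ m f (of hσ m i y) = f i y := by
  classical
  exact DirectSum.toAddMonoid_of f i y

/-- `R` acts diagonally. -/
noncomputable def opR : R →+* AddMonoid.End (StringModule hσ m) :=
  RingHom.mk'
    { toFun := fun a => desc hσ m fun i =>
        (of hσ m i).comp (AddMonoidHom.mulLeft (Ideal.Quotient.mk _ a))
      map_one' := end_ext hσ m fun i r => by
        refine (desc_of hσ m _ i _).trans ?_
        rw [map_one, AddMonoidHom.comp_apply, AddMonoidHom.coe_mulLeft, one_mul]
        rfl
      map_mul' := fun a b => end_ext hσ m fun i r => by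
        rw [end_mul_apply, desc_of, desc_of, AddMonoidHom.comp_apply, AddMonoidHom.comp_apply,
          desc_of, AddMonoidHom.comp_apply, AddMonoidHom.coe_mulLeft, AddMonoidHom.coe_mulLeft,
          AddMonoidHom.coe_mulLeft, map_mul (Ideal.Quotient.mk _), mul_assoc] }
    (fun a b => end_ext hσ m fun i r => by
      refine (desc_of hσ m _ i _).trans (Eq.trans ?_ (congrArg₂ (· + ·)
        (desc_of hσ m _ i _) (desc_of hσ m _ i _)).symm)
      simp [add_mul])

/-- The isomorphism `R / m_i ≃ R / m_{i+1}`, `r + m_i ↦ σ(r) + m_{i+1}`. -/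
noncomputable def stepEquiv (i j : S) (h : (j : ℤ) = i + 1) :
    R ⧸ (m.ideal i).asIdeal ≃+* R ⧸ (m.ideal j).asIdeal :=
  residueEquiv σ (m.ideal i) (m.ideal j) (m.step i j h) (hσ.exists_sub_mem _)

open Classical in
/-- `X` sends `r + m_i` to `σ(t r) + m_{i+1}` if `i + 1 ∈ S`, and to `0` otherwise. -/
noncomputable def opX : AddMonoid.End (StringModule hσ m) :=
  desc hσ m fun i =>
    if h : (i : ℤ) + 1 ∈ S then
      (of hσ m ⟨i + 1, h⟩).comp
        ((stepEquiv hσ m i ⟨i + 1, h⟩ rfl : _ →+ _).comp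
          (AddMonoidHom.mulLeft (Ideal.Quotient.mk _ t)))
    else 0

open Classical in
/-- `Y` sends `r + m_i` to `s + m_{i-1}`, where `σ(s) ∈ r + m_i`, if `i - 1 ∈ S`,
and to `0` otherwise. -/
noncomputable def opY : AddMonoid.End (StringModule hσ m) :=
  desc hσ m fun i =>
    if h : (i : ℤ) - 1 ∈ S then
      (of hσ m ⟨i - 1, h⟩).comp
        ((stepEquiv hσ m ⟨i - 1, h⟩ i (by simp)).symm : _ →+ _)
    else 0

theorem opR_of (a : R) (i : S) (r : R) :
    opR hσ m a (of hσ m i (Ideal.Quotient.mk _ r)) = of hσ m i (Ideal.Quotient.mk _ (a * r)) := by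
  refine (desc_of hσ m _ i _).trans ?_
  simp

theorem opX_of (i j : S) (h : (j : ℤ) = i + 1) (r : R) :
    opX hσ m (of hσ m i (Ideal.Quotient.mk _ r)) =
      of hσ m j (Ideal.Quotient.mk _ (σ (t * r))) := by
  obtain ⟨j, hj⟩ := j
  obtain rfl : j = i + 1 := h
  refine (desc_of hσ m _ i _).trans ?_
  rw [dif_pos hj]
  simp only [AddMonoidHom.comp_apply, AddMonoidHom.coe_mulLeft, ← map_mul]
  exact congrArg (of hσ m ⟨i + 1, hj⟩) (residueEquiv_mk ..)

theorem opX_of_end (i : S) (h : (i : ℤ) + 1 ∉ S) (y : R ⧸ (m.ideal i).asIdeal) :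
    opX hσ m (of hσ m i y) = 0 := by
  refine (desc_of hσ m _ i _).trans ?_
  rw [dif_neg h]; rfl

theorem opY_of (i j : S) (h : (j : ℤ) = i + 1) (s : R) :
    opY hσ m (of hσ m j (Ideal.Quotient.mk _ (σ s))) = of hσ m i (Ideal.Quotient.mk _ s) := by
  obtain ⟨i, hi⟩ := i
  obtain rfl : i = j - 1 := by rw [h]; simp
  refine (desc_of hσ m _ j _).trans ?_
  rw [dif_pos hi]
  simp only [AddMonoidHom.comp_apply]
  congr 1
  exact (RingEquiv.symm_apply_eq _).2 (residueEquiv_mk ..).symm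

theorem opY_of_end (i : S) (h : (i : ℤ) - 1 ∉ S) (y : R ⧸ (m.ideal i).asIdeal) :
    opY hσ m (of hσ m i y) = 0 := by
  refine (desc_of hσ m _ i _).trans ?_
  rw [dif_neg h]; rfl

/-- A class in `R / m_j` is the class of some `σ(s)`. -/
theorem mk_eq (hσ : IsEssential σ) (m : StringChain σ t S) (j : S) (r : R) :
    ∃ s, (Ideal.Quotient.mk (m.ideal j).asIdeal r) = Ideal.Quotient.mk _ (σ s) := by
  obtain ⟨s, hs⟩ := hσ.exists_sub_mem (m.ideal j) r
  exact ⟨s, (Ideal.Quotient.eq.2 hs).symm⟩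

/-- The action of `A(R, σ, t)` on the string module. -/
noncomputable def action : WGWA σ t →+* AddMonoid.End (StringModule hσ m) :=
  WGWA.lift (opR hσ m) (opX hσ m) (opY hσ m)
    (end_ext hσ m fun i r => by
      rw [end_mul_apply, opR_of]
      by_cases h : (i : ℤ) + 1 ∈ S
      · rw [opX_of hσ m i ⟨i + 1, h⟩ rfl, opY_of hσ m i ⟨i + 1, h⟩ rfl]
      · rw [opX_of_end hσ m i h, map_zero, Ideal.Quotient.eq_zero_iff_mem.2, map_zero]
        exact Ideal.mul_mem_right _ _ (m.right_end i h))
    (end_ext hσ m fun i r => by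
      rw [end_mul_apply, opR_of]
      by_cases h : (i : ℤ) - 1 ∈ S
      · obtain ⟨s, hs⟩ := mk_eq hσ m i r
        rw [map_mul, hs, ← map_mul, ← map_mul, opY_of hσ m ⟨i - 1, h⟩ i (by simp),
          opX_of hσ m ⟨i - 1, h⟩ i (by simp)]
      · rw [opY_of_end hσ m i h, map_zero, Ideal.Quotient.eq_zero_iff_mem.2, map_zero]
        exact Ideal.mul_mem_right _ _ (m.left_end i h))
    (fun a => end_ext hσ m fun i r => by
      rw [end_mul_apply, end_mul_apply, opR_of]
      by_cases h : (i : ℤ) + 1 ∈ S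
      · rw [opX_of hσ m i ⟨i + 1, h⟩ rfl, opX_of hσ m i ⟨i + 1, h⟩ rfl, opR_of, ← map_mul,
          mul_left_comm]
      · rw [opX_of_end hσ m i h, opX_of_end hσ m i h, map_zero])
    (fun a => end_ext hσ m fun i r => by
      rw [end_mul_apply, end_mul_apply, opR_of]
      by_cases h : (i : ℤ) - 1 ∈ S
      · obtain ⟨s, hs⟩ := mk_eq hσ m i r
        rw [map_mul, hs, ← map_mul, ← map_mul, opY_of hσ m ⟨i - 1, h⟩ i (by simp),
          opY_of hσ m ⟨i - 1, h⟩ i (by simp), opR_of]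
      · rw [opY_of_end hσ m i h, opY_of_end hσ m i h, map_zero])

noncomputable instance : Module (WGWA σ t) (StringModule hσ m) :=
  Module.compHom _ (action hσ m)

end StringModule

/-! ## Skew Laurent polynomial rings -/

/-- The skew Laurent polynomial ring `k[α, α⁻¹; φ]`, in which `α c = φ(c) α` for `c ∈ k`. -/
def SkewLaurent (k : Type u) [CommRing k] (_φ : k ≃+* k) : Type u :=
  SkewMonoidAlgebra k (Multiplicative ℤ)

namespace SkewLaurent

variable {k : Type u} [CommRing k] (φ : k ≃+* k)

/-- The infinite cyclic group generated by `α` acts on `k` through the powers of `φ`. -/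
@[reducible]
def cyclicAction : MulSemiringAction (Multiplicative ℤ) k :=
  MulSemiringAction.compHom k (zpowersHom (RingAut k) φ)

noncomputable instance : Ring (SkewLaurent k φ) :=
  letI := cyclicAction φ
  inferInstanceAs (Ring (SkewMonoidAlgebra k (Multiplicative ℤ)))

/-- The inclusion of the coefficients. -/
noncomputable def C : k →+* SkewLaurent k φ :=
  letI := cyclicAction φ
  (SkewMonoidAlgebra.singleOneRingHom : k →+* SkewMonoidAlgebra k (Multiplicative ℤ))

/-- The variable `α`, as a unit. -/
noncomputable def α : (SkewLaurent k φ)ˣ :=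
  letI := cyclicAction φ
  { val := SkewMonoidAlgebra.single (Multiplicative.ofAdd (1 : ℤ)) (1 : k)
    inv := SkewMonoidAlgebra.single (Multiplicative.ofAdd (-1 : ℤ)) (1 : k)
    val_inv := by
      refine (SkewMonoidAlgebra.single_mul_single (k := k) (G := Multiplicative ℤ)).trans ?_
      rw [smul_one, mul_one]; rfl
    inv_val := by
      refine (SkewMonoidAlgebra.single_mul_single (k := k) (G := Multiplicative ℤ)).trans ?_
      rw [smul_one, mul_one]; rfl }

theorem α_mul_C (c : k) : (α φ : SkewLaurent k φ) * C φ c = C φ (φ c) * α φ := by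
  let := cyclicAction φ
  refine (SkewMonoidAlgebra.single_mul_single (k := k) (G := Multiplicative ℤ)).trans ?_
  refine Eq.trans ?_ (SkewMonoidAlgebra.single_mul_single (k := k) (G := Multiplicative ℤ)).symm
  rw [smul_one, mul_one, one_mul, one_mul, mul_one]
  congr 1

theorem C_mul_α_inv (c : k) :
    C φ c * ((α φ)⁻¹ : (SkewLaurent k φ)ˣ) = ((α φ)⁻¹ : (SkewLaurent k φ)ˣ) * C φ (φ c) := by
  rw [Units.mul_inv_eq_iff_eq_mul, mul_assoc, ← α_mul_C, Units.inv_mul_cancel_left]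

/-- The left module `L_f = P / P f` over `P = k[α, α⁻¹; φ]`. -/
abbrev quot (f : SkewLaurent k φ) : Type u := SkewLaurent k φ ⧸ Ideal.span {f}

end SkewLaurent

/-! ## Band modules -/

/-- A doubly infinite chain of maximal ideals `(m_i)`, `i ∈ ℤ`, with `σ(m_i) ⊆ m_{i+1}` that is
periodic with minimal period `n + 1`. -/
structure PeriodicChain (σ : R →+* R) (n : ℕ) where
  ideal : ℤ → MaximalSpectrum R
  step : ∀ i, (ideal i).asIdeal ≤ (ideal (i + 1)).asIdeal.comap σ
  periodic : ∀ i, ideal (i + (n + 1 : ℕ)) = ideal i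
  minimal : ∀ l : ℕ, 0 < l → (∀ i, ideal (i + l) = ideal i) → n + 1 ≤ l

namespace PeriodicChain

variable {σ : R →+* R} {n : ℕ} (m : PeriodicChain σ n)

theorem le_comap_pow (l : ℕ) (a b : ℤ) (h : a + l = b) :
    (m.ideal a).asIdeal ≤ (m.ideal b).asIdeal.comap (σ ^ l) := by
  induction l generalizing b with
  | zero =>
    obtain rfl : a = b := by simpa using h
    exact fun r hr => hr
  | succ l ih =>
    obtain rfl : a + l + 1 = b := by rw [← h]; push_cast; ring
    intro r hr
    have h1 : (σ ^ l) r ∈ (m.ideal (a + l)).asIdeal := ih _ rfl hr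
    have h2 := m.step _ h1
    rw [Ideal.mem_comap, pow_succ']
    exact h2

theorem exists_pow_sub_mem (hσ : IsEssential σ) (l : ℕ) (a b : ℤ) (h : a + l = b) (r : R) :
    ∃ s, (σ ^ l) s - r ∈ (m.ideal b).asIdeal := by
  induction l generalizing b r with
  | zero => exact ⟨r, by simp⟩
  | succ l ih =>
    obtain rfl : a + l + 1 = b := by rw [← h]; push_cast; ring
    obtain ⟨s₁, h₁⟩ := hσ.exists_sub_mem (m.ideal (a + l + 1)) r
    obtain ⟨s, hs⟩ := ih (a + l) rfl s₁
    have h2 : σ ((σ ^ l) s - s₁) ∈ (m.ideal (a + l + 1)).asIdeal := m.step _ hs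
    refine ⟨s, ?_⟩
    have h3 := add_mem h2 h₁
    rw [map_sub, sub_add_sub_cancel] at h3
    rw [pow_succ']
    exact h3

variable (hσ : IsEssential σ)

/-- The isomorphism `τ_l : R / m_a ≃ R / m_{a+l}`, `r + m_a ↦ σ^l(r) + m_{a+l}`. -/
noncomputable def tau (l : ℕ) (a b : ℤ) (h : a + l = b) :
    R ⧸ (m.ideal a).asIdeal ≃+* R ⧸ (m.ideal b).asIdeal :=
  residueEquiv (σ ^ l) (m.ideal a) (m.ideal b) (m.le_comap_pow l a b h)
    (m.exists_pow_sub_mem hσ l a b h)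

theorem tau_mk (l : ℕ) (a b : ℤ) (h : a + l = b) (r : R) :
    m.tau hσ l a b h (Ideal.Quotient.mk _ r) = Ideal.Quotient.mk _ ((σ ^ l) r) :=
  residueEquiv_mk ..

/-- The field `k = R / m_0`. -/
abbrev k : Type u := R ⧸ (m.ideal 0).asIdeal

theorem ideal_period : m.ideal ((n + 1 : ℕ) : ℤ) = m.ideal 0 := by
  have := m.periodic 0
  rwa [zero_add] at this

/-- The automorphism `σ̄` of `k = R / m_0` induced by `σ^{n+1}`, where `n + 1` is the minimal
period; it is `τ_{n+1}` followed by the identification `m_{n+1} = m_0`. -/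
noncomputable def sigmaBar : m.k ≃+* m.k :=
  (m.tau hσ (n + 1) 0 ((n + 1 : ℕ) : ℤ) (zero_add _)).trans
    (Ideal.quotEquivOfEq (congrArg MaximalSpectrum.asIdeal m.ideal_period))

theorem sigmaBar_mk (r : R) :
    m.sigmaBar hσ (Ideal.Quotient.mk _ r) = Ideal.Quotient.mk _ ((σ ^ (n + 1)) r) := by
  rw [sigmaBar, RingEquiv.trans_apply, tau_mk, Ideal.quotEquivOfEq_mk]

/-- The skew Laurent polynomial ring `P = k[α, α⁻¹; σ̄]`. -/
abbrev P : Type u := SkewLaurent m.k (m.sigmaBar hσ)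

/-- The left `P`-module `L_f = P / P f`. -/
abbrev L (f : m.P hσ) : Type u := SkewLaurent.quot (m.sigmaBar hσ) f

end PeriodicChain

/-- The diagonal action of `R` on `Lᵈ` through a family of ring homomorphisms `R → P`, where `L`
is a `P`-module. -/
def diagAction {P : Type u} [Ring P] {L : Type u} [AddCommGroup L] [Module P L] {d : ℕ}
    (φ : Fin d → R →+* P) : R →+* AddMonoid.End (Fin d → L) :=
  RingHom.mk'
    { toFun := fun r =>
        { toFun := fun w i => φ i r • w i
          map_zero' := funext fun _ => smul_zero _
          map_add' := fun _ _ => funext fun _ => smul_add _ _ _ }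
      map_one' := AddMonoidHom.ext fun w => funext fun i => by
        change φ i 1 • w i = w i
        rw [map_one, one_smul]
      map_mul' := fun r s => AddMonoidHom.ext fun w => funext fun i => by
        change φ i (r * s) • w i = φ i r • φ i s • w i
        rw [map_mul, mul_smul] }
    (fun r s => AddMonoidHom.ext fun w => funext fun i => by
      change φ i (r + s) • w i = φ i r • w i + φ i s • w i
      rw [map_add, add_smul])

/-- `(w_0, …, w_n) ↦ (u w_n, w_0, …, w_{n-1})`, as an additive bijection of `L^{n+1}`, where `L`
is a `P`-module and `u` a unit of `P`. -/
def cyclicShift {P : Type u} [Ring P] {L : Type u} [AddCommGroup L] [Module P L] (n : ℕ) (u : Pˣ) :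
    (Fin (n + 1) → L) ≃+ (Fin (n + 1) → L) where
  toFun w := Fin.cons ((u : P) • w (Fin.last n)) (fun i : Fin n => w i.castSucc)
  invFun w := Fin.snoc (fun i : Fin n => w i.succ) (((u⁻¹ : Pˣ) : P) • w 0)
  left_inv w := by
    funext i
    refine Fin.lastCases ?_ (fun i => ?_) i
    · simp [smul_smul]
    · simp
  right_inv w := by
    funext i
    refine Fin.cases ?_ (fun i => ?_) i
    · simp [smul_smul]
    · simp
  map_add' w w' := by
    funext i
    refine Fin.cases ?_ (fun i => ?_) i
    · simp
    · simp

section Band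

variable {σ : R →+* R} {n : ℕ}

/-- The underlying group of the band module `M^f`: the entry `w i`, `0 ≤ i ≤ n`, is the component
in the weight space `M^f_{m_{-i}} = L_f`. -/
def BandModuleM (hσ : IsEssential σ) (_t : R) (m : PeriodicChain σ n) (f : m.P hσ) : Type u :=
  Fin (n + 1) → m.L hσ f

namespace BandModuleM

variable (hσ : IsEssential σ) (t : R) (m : PeriodicChain σ n) (f : m.P hσ)

noncomputable instance : AddCommGroup (BandModuleM hσ t m f) :=
  inferInstanceAs (AddCommGroup (Fin (n + 1) → m.L hσ f))

/-- `r` acts on `M^f_{m_{-i}} = L_f` as `τ_i(r + m_{-i}) ∈ k`. -/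
noncomputable def scalar (i : Fin (n + 1)) : R →+* m.P hσ :=
  (SkewLaurent.C (m.sigmaBar hσ)).comp
    ((m.tau hσ i (-(i : ℤ)) 0 (by simp) : _ →+* _).comp
      (Ideal.Quotient.mk (m.ideal (-(i : ℤ))).asIdeal))

theorem scalar_apply (i : Fin (n + 1)) (r : R) :
    scalar hσ m i r = SkewLaurent.C (m.sigmaBar hσ) (Ideal.Quotient.mk _ ((σ ^ (i : ℕ)) r)) :=
  congrArg (SkewLaurent.C (m.sigmaBar hσ)) (m.tau_mk hσ i (-(i : ℤ)) 0 (by simp) r)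

/-- The action of `R`. -/
noncomputable def opR : R →+* AddMonoid.End (BandModuleM hσ t m f) :=
  (diagAction (scalar hσ m) : R →+* AddMonoid.End (Fin (n + 1) → m.L hσ f))

/-- `Y` is the identity `L_f = M^f_{m_{-i}} → M^f_{m_{-i-1}} = L_f` for `i < n`, and the action of
`α⁻¹` from `M^f_{m_{-n}}` to `M^f_{m_0}`. -/
noncomputable def equivY : BandModuleM hσ t m f ≃+ BandModuleM hσ t m f :=
  (cyclicShift n (SkewLaurent.α (m.sigmaBar hσ))⁻¹ :
    (Fin (n + 1) → m.L hσ f) ≃+ (Fin (n + 1) → m.L hσ f))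

/-- The action of `Y`. -/
noncomputable def opY : AddMonoid.End (BandModuleM hσ t m f) := (equivY hσ t m f).toAddMonoidHom

/-- The inverse of the action of `Y`. -/
noncomputable def invY : AddMonoid.End (BandModuleM hσ t m f) :=
  (equivY hσ t m f).symm.toAddMonoidHom

/-- `X` sends `Y w` to `σ(t) w`. -/
noncomputable def opX : AddMonoid.End (BandModuleM hσ t m f) :=
  opR hσ t m f (σ t) * invY hσ t m f

theorem opX_equivY (w : BandModuleM hσ t m f) :
    opX hσ t m f (equivY hσ t m f w) = opR hσ t m f (σ t) w := by
  rw [opX, end_mul_apply]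
  exact congrArg (opR hσ t m f (σ t)) ((equivY hσ t m f).symm_apply_apply w)

theorem ry (r : R) : opR hσ t m f r * opY hσ t m f = opY hσ t m f * opR hσ t m f (σ r) := by
  refine AddMonoidHom.ext fun w => funext fun i => ?_
  refine Fin.cases ?_ (fun j => ?_) i
  · change scalar hσ m 0 r • ((((SkewLaurent.α (m.sigmaBar hσ))⁻¹ : (m.P hσ)ˣ) : m.P hσ) •
      w (Fin.last n)) = (((SkewLaurent.α (m.sigmaBar hσ))⁻¹ : (m.P hσ)ˣ) : m.P hσ) •
        (scalar hσ m (Fin.last n) (σ r) • w (Fin.last n))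
    rw [scalar_apply, scalar_apply, smul_smul, smul_smul, SkewLaurent.C_mul_α_inv, m.sigmaBar_mk hσ]
    rfl
  · change scalar hσ m j.succ r • w j.castSucc = scalar hσ m j.castSucc (σ r) • w j.castSucc
    rw [scalar_apply, scalar_apply]
    rfl

/-- The action of `A(R, σ, t)` on `M^f`. -/
noncomputable def action : WGWA σ t →+* AddMonoid.End (BandModuleM hσ t m f) :=
  WGWA.lift (opR hσ t m f) (opX hσ t m f) (opY hσ t m f)
    (by
      rw [opX, ← mul_assoc, ← ry, mul_assoc]
      refine AddMonoidHom.ext fun w => ?_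
      exact congrArg (opR hσ t m f t) ((equivY hσ t m f).apply_symm_apply w))
    (by
      rw [opX, mul_assoc]
      refine AddMonoidHom.ext fun w => ?_
      exact congrArg (opR hσ t m f (σ t)) ((equivY hσ t m f).symm_apply_apply w))
    (fun r => AddMonoidHom.ext fun w => by
      obtain ⟨w, rfl⟩ := (equivY hσ t m f).surjective w
      have h1 : opR hσ t m f r (equivY hσ t m f w) = equivY hσ t m f (opR hσ t m f (σ r) w) :=
        DFunLike.congr_fun (ry hσ t m f r) w
      have h2 := opX_equivY hσ t m f
      change opX hσ t m f (opR hσ t m f r (equivY hσ t m f w)) =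
        opR hσ t m f (σ r) (opX hσ t m f (equivY hσ t m f w))
      rw [h1, h2, h2,
        ← end_mul_apply, ← end_mul_apply, ← map_mul, ← map_mul,
        ← map_mul, ← map_mul, mul_comm])
    (ry hσ t m f)

noncomputable instance : Module (WGWA σ t) (BandModuleM hσ t m f) :=
  Module.compHom _ (action hσ t m f)

end BandModuleM

/-- The underlying group of the band module `N^f`: the entry `w i`, `0 ≤ i ≤ n`, is the component
in the weight space `N^f_{m_i} = L_f`. -/
def BandModuleN (hσ : IsEssential σ) (_t : R) (m : PeriodicChain σ n) (f : m.P hσ) : Type u :=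
  Fin (n + 1) → m.L hσ f

namespace BandModuleN

variable (hσ : IsEssential σ) (t : R) (m : PeriodicChain σ n) (f : m.P hσ)

noncomputable instance : AddCommGroup (BandModuleN hσ t m f) :=
  inferInstanceAs (AddCommGroup (Fin (n + 1) → m.L hσ f))

/-- `r` acts on `N^f_{m_i} = L_f` as `τ_i⁻¹(r + m_i) ∈ k`. -/
noncomputable def scalar (i : Fin (n + 1)) : R →+* m.P hσ :=
  (SkewLaurent.C (m.sigmaBar hσ)).comp
    (((m.tau hσ i 0 (i : ℤ) (zero_add _)).symm : _ →+* _).comp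
      (Ideal.Quotient.mk (m.ideal (i : ℤ)).asIdeal))

theorem scalar_apply (i : Fin (n + 1)) (r s : R)
    (h : (σ ^ (i : ℕ)) s - r ∈ (m.ideal (i : ℤ)).asIdeal) :
    scalar hσ m i r = SkewLaurent.C (m.sigmaBar hσ) (Ideal.Quotient.mk _ s) := by
  refine congrArg (SkewLaurent.C (m.sigmaBar hσ))
    ((RingEquiv.symm_apply_eq (m.tau hσ i 0 (i : ℤ) (zero_add _))).2 ?_)
  rw [m.tau_mk hσ]
  exact (Ideal.Quotient.eq.2 h).symm

/-- The action of `R`. -/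
noncomputable def opR : R →+* AddMonoid.End (BandModuleN hσ t m f) :=
  (diagAction (scalar hσ m) : R →+* AddMonoid.End (Fin (n + 1) → m.L hσ f))

/-- `X` is the identity `L_f = N^f_{m_i} → N^f_{m_{i+1}} = L_f` for `i < n`, and the action of `α`
from `N^f_{m_n}` to `N^f_{m_0}`. -/
noncomputable def equivX : BandModuleN hσ t m f ≃+ BandModuleN hσ t m f :=
  (cyclicShift n (SkewLaurent.α (m.sigmaBar hσ)) :
    (Fin (n + 1) → m.L hσ f) ≃+ (Fin (n + 1) → m.L hσ f))

/-- The action of `X`. -/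
noncomputable def opX : AddMonoid.End (BandModuleN hσ t m f) := (equivX hσ t m f).toAddMonoidHom

/-- The inverse of the action of `X`. -/
noncomputable def invX : AddMonoid.End (BandModuleN hσ t m f) :=
  (equivX hσ t m f).symm.toAddMonoidHom

/-- `Y` sends `X w` to `t w`. -/
noncomputable def opY : AddMonoid.End (BandModuleN hσ t m f) :=
  opR hσ t m f t * invX hσ t m f

theorem opY_equivX (w : BandModuleN hσ t m f) :
    opY hσ t m f (equivX hσ t m f w) = opR hσ t m f t w := by
  rw [opY, end_mul_apply]
  exact congrArg (opR hσ t m f t) ((equivX hσ t m f).symm_apply_apply w)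

theorem xr (r : R) : opX hσ t m f * opR hσ t m f r = opR hσ t m f (σ r) * opX hσ t m f := by
  refine AddMonoidHom.ext fun w => funext fun i => ?_
  refine Fin.cases ?_ (fun j => ?_) i
  · change (SkewLaurent.α (m.sigmaBar hσ) : m.P hσ) • (scalar hσ m (Fin.last n) r • w (Fin.last n))
      = scalar hσ m 0 (σ r) • ((SkewLaurent.α (m.sigmaBar hσ) : m.P hσ) • w (Fin.last n))
    obtain ⟨s, hs⟩ := m.exists_pow_sub_mem hσ n 0 n (zero_add _) r
    have h1 : (σ ^ (n + 1)) s - σ r ∈ (m.ideal 0).asIdeal := by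
      have h2 : σ ((σ ^ n) s - r) ∈ (m.ideal ((n : ℤ) + 1)).asIdeal := m.step _ hs
      have h3 : m.ideal ((n : ℤ) + 1) = m.ideal 0 := by
        have := m.ideal_period
        push_cast at this
        exact this
      rw [h3, map_sub] at h2
      rw [pow_succ']
      exact h2
    rw [scalar_apply hσ m (Fin.last n) r s hs, scalar_apply hσ m 0 (σ r) _ h1, smul_smul, smul_smul,
      SkewLaurent.α_mul_C, m.sigmaBar_mk hσ]
    rfl
  · change scalar hσ m j.castSucc r • w j.castSucc = scalar hσ m j.succ (σ r) • w j.castSucc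
    obtain ⟨s, hs⟩ := m.exists_pow_sub_mem hσ j 0 j (zero_add _) r
    have h1 : (σ ^ ((j : ℕ) + 1)) s - σ r ∈ (m.ideal ((j : ℤ) + 1)).asIdeal := by
      have h2 : σ ((σ ^ (j : ℕ)) s - r) ∈ (m.ideal ((j : ℤ) + 1)).asIdeal := m.step _ hs
      rw [map_sub] at h2
      rw [pow_succ']
      exact h2
    rw [scalar_apply hσ m j.castSucc r s hs, scalar_apply hσ m j.succ (σ r) s (by
      simpa only [Fin.val_succ, Nat.cast_add, Nat.cast_one] using h1)]

/-- The action of `A(R, σ, t)` on `N^f`. -/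
noncomputable def action : WGWA σ t →+* AddMonoid.End (BandModuleN hσ t m f) :=
  WGWA.lift (opR hσ t m f) (opX hσ t m f) (opY hσ t m f)
    (by
      rw [opY, mul_assoc]
      refine AddMonoidHom.ext fun w => ?_
      exact congrArg (opR hσ t m f t) ((equivX hσ t m f).symm_apply_apply w))
    (by
      rw [opY, ← mul_assoc, xr, mul_assoc]
      refine AddMonoidHom.ext fun w => ?_
      exact congrArg (opR hσ t m f (σ t)) ((equivX hσ t m f).apply_symm_apply w))
    (xr hσ t m f)
    (fun r => AddMonoidHom.ext fun w => by
      obtain ⟨w, rfl⟩ := (equivX hσ t m f).surjective w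
      have h1 : equivX hσ t m f (opR hσ t m f r w) = opR hσ t m f (σ r) (equivX hσ t m f w) :=
        DFunLike.congr_fun (xr hσ t m f r) w
      have h2 := opY_equivX hσ t m f
      change opR hσ t m f r (opY hσ t m f (equivX hσ t m f w)) =
        opY hσ t m f (opR hσ t m f (σ r) (equivX hσ t m f w))
      rw [← h1, h2, h2,
        ← end_mul_apply, ← end_mul_apply, ← map_mul, ← map_mul, mul_comm])

noncomputable instance : Module (WGWA σ t) (BandModuleN hσ t m f) :=
  Module.compHom _ (action hσ t m f)

end BandModuleN

end Band

/-! ## The classes of modules in the classification -/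

section Classes

variable {σ : R →+* R} (hσ : IsEssential σ) (t : R)
variable (V : Type v) [AddCommGroup V] [Module (WGWA σ t) V]

/-- `V ≅ N_n(m)` for some bounded chain `m = (m_0, …, m_n)`. -/
def IsBoundedString : Prop :=
  ∃ (n : ℕ) (m : StringChain σ t (Set.Icc 0 (n : ℤ))), Nonempty (V ≃ₗ[WGWA σ t] StringModule hσ m)

/-- `V ≅ N↑(m)` for some chain `m = (m_0, m_1, m_2, …)`. -/
def IsRightInfiniteString : Prop :=
  ∃ m : StringChain σ t (Set.Ici 0), Nonempty (V ≃ₗ[WGWA σ t] StringModule hσ m)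

/-- `V ≅ N↓(m)` for some chain `m = (…, m_{-2}, m_{-1}, m_0)`. -/
def IsLeftInfiniteString : Prop :=
  ∃ m : StringChain σ t (Set.Iic 0), Nonempty (V ≃ₗ[WGWA σ t] StringModule hσ m)

/-- `V ≅ N(m)` for some doubly infinite chain `m = (…, m_{-1}, m_0, m_1, …)`. -/
def IsDoublyInfiniteString : Prop :=
  ∃ m : StringChain σ t Set.univ, Nonempty (V ≃ₗ[WGWA σ t] StringModule hσ m)

/-- `V` is (isomorphic to) a string module. -/
def IsStringModule : Prop :=
  IsBoundedString hσ t V ∨ IsRightInfiniteString hσ t V ∨ IsLeftInfiniteString hσ t V ∨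
    IsDoublyInfiniteString hσ t V

/-- `V` is (isomorphic to) a band module `M^f` or `N^f`, for a periodic chain and an irreducible
element `f` of the associated skew Laurent polynomial ring. -/
def IsBandModule : Prop :=
  ∃ (n : ℕ) (m : PeriodicChain σ n) (f : m.P hσ), Irreducible f ∧
    (Nonempty (V ≃ₗ[WGWA σ t] BandModuleM hσ t m f) ∨
      Nonempty (V ≃ₗ[WGWA σ t] BandModuleN hσ t m f))

end Classes

end Algebra

/-!
Write `φ(m) = σ⁻¹(m)` for the self-map of the maximal spectrum of `R` (`IsEssential.pull`). On a
weight module `Y` maps `V_m` into `V_{φ(m)}`, whereas `X` maps `V_m` into the sum of all `V_q`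
with `φ(q) = m`: as `φ` need not be injective, `X v` need not be a weight vector when `v` is one.
A vector all of whose images `Xʲ v` are weight vectors is called straight. Every simple weight
module contains a nonzero straight vector (`exists_isStraight`). If all weights are periodic under
`φ`, this is because `φ` is injective on periodic points. Otherwise, any vector of nonperiodic
weight is straight, because any two weights are iterated images of a common maximal ideal.

The argument then distinguishes three cases.

* `X` kills a weight vector `x ≠ 0`. If `X` kills no further nonzero `Yʲ x`, applying powers of `X`
  shows that the `Yʲ x` are independent over `R`, and `V` is a bounded or left infinite string.
* `X` is injective on weight vectors and `Y` kills a straight vector `w ≠ 0`. If `Y` kills no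
  `Xʲ w` with `j ≥ 1`, one can rescale the `Xʲ w` to a sequence lifted by `Y`
  (`exists_sequence`), and `V` is a right infinite string.
* Neither happens. Then the `Yʲ v` and the rescaled `Xʲ v`, for a straight vector `v`, form a
  doubly infinite sequence. If it is independent, `V` is a doubly infinite string.

In each case, simplicity makes `V` the span of the sequence (`nonempty_equiv_stringModule`). In
the remaining subcases the span of a proper part of the sequence is a submodule, or the sequence
satisfies a relation. Either way, all weights are periodic, and `X` or `Y` is bijective. For
periodic weights a cycle of `X` or `Y` around the weights of `V` turns one weight space into
a module over the skew Laurent polynomial ring `𝕜[α, α⁻¹; σ̄]`. Left ideals of this ring are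
principal (`SkewLaurent.exists_eq_span_singleton`), so the annihilator of a nonzero vector is
generated by one element `f`, which simplicity of `V` makes irreducible, and `V` is a band
module (`isBandModule_of_Y`, `isBandModule_of_X`).
-/

/-! ### The map on maximal ideals induced by an essential endomorphism -/

section Pull

variable {R : Type u} [CommRing R] {σ : R →+* R}

/-- The self-map `m ↦ σ⁻¹(m)` of the maximal spectrum. It is well defined because essentiality
makes `R → R / m`, `r ↦ σ(r) + m`, surjective. -/
def IsEssential.pull (hσ : IsEssential σ) (m : MaximalSpectrum R) : MaximalSpectrum R where
  asIdeal := m.asIdeal.comap σ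
  isMaximal := by
    have hs : Function.Surjective ((Ideal.Quotient.mk m.asIdeal).comp σ) := fun y => by
      obtain ⟨r, rfl⟩ := Ideal.Quotient.mk_surjective y
      obtain ⟨s, hs⟩ := hσ.exists_sub_mem m r
      exact ⟨s, Ideal.Quotient.eq.2 hs⟩
    have hm := m.isMaximal
    have h : m.asIdeal.comap σ =
        (⊥ : Ideal (R ⧸ m.asIdeal)).comap ((Ideal.Quotient.mk m.asIdeal).comp σ) := by
      ext r
      simp [Ideal.mem_comap, Ideal.Quotient.eq_zero_iff_mem]
    have hbot : (⊥ : Ideal (R ⧸ m.asIdeal)).IsMaximal :=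
      (Ideal.bot_quotient_isMaximal_iff _).2 hm
    rw [h]
    exact Ideal.comap_isMaximal_of_surjective _ hs

variable (hσ : IsEssential σ)

theorem IsEssential.mem_pull {m : MaximalSpectrum R} {r : R} :
    r ∈ (hσ.pull m).asIdeal ↔ σ r ∈ m.asIdeal := Iff.rfl

theorem IsEssential.pull_eq_of_le {p q : MaximalSpectrum R}
    (h : p.asIdeal ≤ q.asIdeal.comap σ) : hσ.pull q = p :=
  (MaximalSpectrum.ext (p.isMaximal.eq_of_le (hσ.pull q).isMaximal.ne_top h)).symm

theorem IsEssential.mem_pull_iterate (j : ℕ) {m : MaximalSpectrum R} {r : R} :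
    r ∈ (hσ.pull^[j] m).asIdeal ↔ (σ ^ j) r ∈ m.asIdeal := by
  induction j generalizing r with
  | zero => simp
  | succ j ih =>
    rw [Function.iterate_succ_apply', hσ.mem_pull, ih, pow_succ]
    rfl

theorem IsEssential.exists_pow_sub_mem (hσ : IsEssential σ) (j : ℕ) (m : MaximalSpectrum R)
    (r : R) : ∃ s, (σ ^ j) s - r ∈ m.asIdeal := by
  induction j generalizing m r with
  | zero => exact ⟨r, by simp⟩
  | succ j ih =>
    obtain ⟨s₁, h₁⟩ := ih m r
    obtain ⟨s, hs⟩ := hσ.exists_sub_mem (hσ.pull^[j] m) s₁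
    refine ⟨s, ?_⟩
    have h3 := add_mem ((hσ.mem_pull_iterate j).1 hs) h₁
    rw [map_sub, sub_add_sub_cancel] at h3
    rw [pow_succ]
    exact h3

theorem IsEssential.pull_iterate_injOn {p q : MaximalSpectrum R}
    (hp : p ∈ Function.periodicPts hσ.pull)
    (hq : q ∈ Function.periodicPts hσ.pull) {j : ℕ} (h : hσ.pull^[j] p = hσ.pull^[j] q) : p = q :=
  have hb := Function.bijOn_periodicPts hσ.pull
  hb.injOn.iterate hb.mapsTo j hp hq h

end Pull

/-! ### Modules over a weak generalized Weyl algebra -/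

namespace WGWA

section Generators

variable {R : Type u} [CommRing R] {σ : R →+* R} {t : R}

/-- A property of elements of `A(R, σ, t)` that holds for `R`, `X` and `Y` and is stable under
sums and products holds everywhere. -/
theorem induction {P : WGWA σ t → Prop} (hr : ∀ r, P (coeff σ t r)) (hX : P (X σ t))
    (hY : P (Y σ t)) (hadd : ∀ a b, P a → P b → P (a + b)) (hmul : ∀ a b, P a → P b → P (a * b))
    (a : WGWA σ t) : P a := by
  obtain ⟨x, rfl⟩ : ∃ x, mk σ t x = a := RingQuot.mkRingHom_surjective _ a
  induction x using FreeAlgebra.induction with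
  | grade0 n =>
    have : mk σ t (algebraMap ℤ _ n) = coeff σ t (n : R) := by
      rw [map_intCast, eq_intCast, map_intCast]
    rw [this]
    exact hr _
  | grade1 g =>
    cases g with
    | coeff r => exact hr r
    | X => exact hX
    | Y => exact hY
  | mul a b ha hb => rw [map_mul]; exact hmul _ _ ha hb
  | add a b ha hb => rw [map_add]; exact hadd _ _ ha hb

variable {V : Type v} [AddCommGroup V] [Module (WGWA σ t) V]

local notation "ρ" => WGWA.coeff σ t
local notation "𝕏" => WGWA.X σ t
local notation "𝕐" => WGWA.Y σ t

theorem coeff_mul_smul (r s : R) (x : V) : ρ (r * s) • x = ρ r • ρ s • x := by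
  rw [map_mul, mul_smul]

theorem Y_smul_X_smul (x : V) : 𝕐 • 𝕏 • x = ρ t • x := by
  rw [smul_smul]
  congr 1
  rw [X, Y, ← map_mul]
  exact mk_rel σ t .yx

theorem X_smul_Y_smul (x : V) : 𝕏 • 𝕐 • x = ρ (σ t) • x := by
  rw [smul_smul]
  congr 1
  rw [X, Y, ← map_mul]
  exact mk_rel σ t .xy

theorem X_smul_coeff_smul (r : R) (x : V) : 𝕏 • ρ r • x = ρ (σ r) • 𝕏 • x := by
  rw [smul_smul, smul_smul]
  congr 1
  exact (map_mul (mk σ t) _ _).symm.trans ((mk_rel σ t (.xr r)).trans (map_mul (mk σ t) _ _))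

theorem coeff_smul_Y_smul (r : R) (x : V) : ρ r • 𝕐 • x = 𝕐 • ρ (σ r) • x := by
  rw [smul_smul, smul_smul]
  congr 1
  exact (map_mul (mk σ t) _ _).symm.trans ((mk_rel σ t (.ry r)).trans (map_mul (mk σ t) _ _))

theorem X_pow_smul_coeff_smul (j : ℕ) (r : R) (x : V) :
    𝕏 ^ j • ρ r • x = ρ ((σ ^ j) r) • 𝕏 ^ j • x := by
  induction j with
  | zero => simp
  | succ j ih =>
    rw [pow_succ', mul_smul, ih, X_smul_coeff_smul, mul_smul, pow_succ']
    rfl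

theorem coeff_smul_Y_pow_smul (j : ℕ) (r : R) (x : V) :
    ρ r • 𝕐 ^ j • x = 𝕐 ^ j • ρ ((σ ^ j) r) • x := by
  induction j generalizing r with
  | zero => simp
  | succ j ih =>
    rw [pow_succ', mul_smul, coeff_smul_Y_smul, ih, mul_smul, pow_succ]
    rfl

theorem X_smul_Y_pow_succ_smul (j : ℕ) (x : V) :
    𝕏 • 𝕐 ^ (j + 1) • x = ρ (σ t) • 𝕐 ^ j • x := by
  rw [pow_succ', mul_smul, X_smul_Y_smul]

theorem Y_smul_X_pow_succ_smul (j : ℕ) (x : V) :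
    𝕐 • 𝕏 ^ (j + 1) • x = ρ t • 𝕏 ^ j • x := by
  rw [pow_succ', mul_smul, Y_smul_X_smul]

/-- An additive map commuting with `R`, `X` and `Y` is `A(R, σ, t)`-linear. -/
def linearMapOf {W : Type*} [AddCommGroup W] [Module (WGWA σ t) W] (f : W →+ V)
    (hr : ∀ r x, f (ρ r • x) = ρ r • f x) (hX : ∀ x, f (𝕏 • x) = 𝕏 • f x)
    (hY : ∀ x, f (𝕐 • x) = 𝕐 • f x) : W →ₗ[WGWA σ t] V where
  toFun := f
  map_add' := map_add f
  map_smul' a := by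
    rw [RingHom.id_apply]
    induction a using WGWA.induction with
    | hr r => exact hr r
    | hX => exact hX
    | hY => exact hY
    | hadd a b ha hb => intro x; rw [add_smul, map_add, ha, hb, add_smul]
    | hmul a b ha hb => intro x; rw [mul_smul, ha, hb, mul_smul]

/-- In a simple module, a nonzero additive subgroup stable under `R`, `X` and `Y` is everything. -/
theorem addSubgroup_eq_top [IsSimpleModule (WGWA σ t) V] (W : AddSubgroup V)
    (hr : ∀ r, ∀ x ∈ W, ρ r • x ∈ W) (hX : ∀ x ∈ W, 𝕏 • x ∈ W) (hY : ∀ x ∈ W, 𝕐 • x ∈ W)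
    (h0 : ∃ x ∈ W, x ≠ 0) : W = ⊤ := by
  let N : Submodule (WGWA σ t) V :=
    { W with
      smul_mem' := fun a => by
        induction a using WGWA.induction with
        | hr r => exact fun hx => hr r _ hx
        | hX => exact fun hx => hX _ hx
        | hY => exact fun hx => hY _ hx
        | hadd a b ha hb => intro x hx; rw [add_smul]; exact W.add_mem (ha hx) (hb hx)
        | hmul a b ha hb => intro x hx; rw [mul_smul]; exact ha (hb hx) }
  have hN : N = ⊤ := (eq_bot_or_eq_top N).resolve_left fun h => by
    obtain ⟨x, hx, hx0⟩ := h0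
    have : x ∈ N := hx
    rw [h] at this
    exact hx0 ((Submodule.mem_bot _).1 this)
  rw [eq_top_iff]
  intro x _
  have : x ∈ N := hN ▸ Submodule.mem_top
  exact this

end Generators

/-! ### Weight vectors -/

section Weights

variable {R : Type u} [CommRing R] {σ : R →+* R} {t : R} (hσ : IsEssential σ)
variable {V : Type v} [AddCommGroup V] [Module (WGWA σ t) V]

local notation "ρ" => WGWA.coeff σ t
local notation "𝕏" => WGWA.X σ t
local notation "𝕐" => WGWA.Y σ t
local notation "wt" => weightSpace σ t V

theorem coeff_smul_mem {p : MaximalSpectrum R} {x : V} (hx : x ∈ wt p) (r : R) :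
    ρ r • x ∈ wt p := fun s hs => by
  rw [smul_smul, ← map_mul, mul_comm, map_mul, mul_smul, hx s hs, smul_zero]

theorem coeff_smul_congr {p : MaximalSpectrum R} {x : V} (hx : x ∈ wt p) {r s : R}
    (h : r - s ∈ p.asIdeal) : ρ r • x = ρ s • x := by
  rw [← sub_eq_zero, ← sub_smul, ← map_sub]
  exact hx _ h

theorem exists_mul_sub_one_mem {p : MaximalSpectrum R} {r : R} (hr : r ∉ p.asIdeal) :
    ∃ s, s * r - 1 ∈ p.asIdeal := by
  obtain ⟨s, i, hi, h⟩ := p.isMaximal.exists_inv hr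
  exact ⟨s, by rw [← h]; simpa using hi⟩

theorem coeff_smul_coeff_smul_of_mul_sub_one_mem {p : MaximalSpectrum R} {x : V} (hx : x ∈ wt p)
    {r s : R} (h : s * r - 1 ∈ p.asIdeal) : ρ s • ρ r • x = x := by
  rw [← coeff_mul_smul, coeff_smul_congr hx h, map_one, one_smul]

theorem coeff_smul_eq_zero_iff {p : MaximalSpectrum R} {x : V} (hx : x ∈ wt p) (h0 : x ≠ 0)
    {r : R} : ρ r • x = 0 ↔ r ∈ p.asIdeal := by
  refine ⟨fun h => ?_, hx r⟩
  by_contra hr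
  obtain ⟨s, hs⟩ := exists_mul_sub_one_mem hr
  have := coeff_smul_coeff_smul_of_mul_sub_one_mem hx hs
  rw [h, smul_zero] at this
  exact h0 this.symm

/-- On the weight space `V_p` the element `r` acts like some `σ^j(s)`. -/
theorem exists_coeff_pow_smul (hσ : IsEssential σ) (j : ℕ) (p : MaximalSpectrum R) (r : R) :
    ∃ s, ∀ x ∈ wt p, ρ r • x = ρ ((σ ^ j) s) • x := by
  obtain ⟨s, hs⟩ := hσ.exists_pow_sub_mem j p r
  exact ⟨s, fun x hx => (coeff_smul_congr hx hs).symm⟩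

theorem exists_coeff_smul (hσ : IsEssential σ) (p : MaximalSpectrum R) (r : R) :
    ∃ s, ∀ x ∈ wt p, ρ r • x = ρ (σ s) • x := by
  obtain ⟨s, hs⟩ := exists_coeff_pow_smul (V := V) (t := t) hσ 1 p r
  exact ⟨s, by simpa using hs⟩

theorem Y_smul_mem {p : MaximalSpectrum R} {x : V} (hx : x ∈ wt p) : 𝕐 • x ∈ wt (hσ.pull p) :=
  fun r hr => by rw [coeff_smul_Y_smul, hx _ hr, smul_zero]

theorem Y_pow_smul_mem {p : MaximalSpectrum R} {x : V} (hx : x ∈ wt p) (j : ℕ) :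
    𝕐 ^ j • x ∈ wt (hσ.pull^[j] p) := by
  induction j with
  | zero => simpa
  | succ j ih =>
    rw [pow_succ', mul_smul, Function.iterate_succ_apply']
    exact Y_smul_mem hσ ih

end Weights

/-! ### Weight components -/

section Components

variable {R : Type u} [CommRing R] {σ : R →+* R} {t : R}
variable {V : Type v} [AddCommGroup V] [Module (WGWA σ t) V] (hV : IsWeightModule σ t V)

local notation "ρ" => WGWA.coeff σ t
local notation "𝕏" => WGWA.X σ t
local notation "𝕐" => WGWA.Y σ t
local notation "wt" => weightSpace σ t V

open Classical in
/-- The projection of a weight module onto its weight space `V_p`. -/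
noncomputable def comp (p : MaximalSpectrum R) : V →+ V :=
  letI := hV.chooseDecomposition
  { toFun := fun x => (DirectSum.decompose (fun m => weightSpace σ t V m) x p : V)
    map_zero' := by simp
    map_add' := fun x y => by simp }

theorem comp_mem (p : MaximalSpectrum R) (x : V) : comp hV p x ∈ wt p := by
  classical
  let := hV.chooseDecomposition
  exact (DirectSum.decompose (fun m => weightSpace σ t V m) x p).2

theorem comp_of_mem {p : MaximalSpectrum R} {x : V} (hx : x ∈ wt p) : comp hV p x = x := by
  classical
  let := hV.chooseDecomposition
  exact DirectSum.decompose_of_mem_same (fun m => weightSpace σ t V m) hx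

theorem comp_of_mem_of_ne {p q : MaximalSpectrum R} {x : V} (hx : x ∈ wt p) (h : p ≠ q) :
    comp hV q x = 0 := by
  classical
  let := hV.chooseDecomposition
  exact DirectSum.decompose_of_mem_ne (fun m => weightSpace σ t V m) hx h

theorem weight_induction (hV : IsWeightModule σ t V) {P : V → Prop} (h0 : P 0)
    (hw : ∀ p, ∀ x ∈ wt p, P x) (hadd : ∀ x y, P x → P y → P (x + y)) (x : V) : P x := by
  classical
  let := hV.chooseDecomposition
  exact DirectSum.Decomposition.inductionOn (fun m => weightSpace σ t V m) h0
    (fun m => hw _ _ m.2) hadd x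

theorem eq_of_comp_eq {x y : V} (h : ∀ p, comp hV p x = comp hV p y) : x = y := by
  classical
  let := hV.chooseDecomposition
  refine (DirectSum.decompose (fun m => weightSpace σ t V m)).injective (DFinsupp.ext fun p => ?_)
  exact Subtype.ext (h p)

theorem eq_zero_of_comp_eq_zero {x : V} (h : ∀ p, comp hV p x = 0) : x = 0 :=
  eq_of_comp_eq hV fun p => by rw [h, map_zero]

theorem eq_of_mem_of_mem (hV : IsWeightModule σ t V) {p q : MaximalSpectrum R} {x : V}
    (hp : x ∈ wt p) (hq : x ∈ wt q) (h0 : x ≠ 0) : p = q := by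
  by_contra h
  exact h0 ((comp_of_mem hV hq).symm.trans (comp_of_mem_of_ne hV hp h))

/-- A vector with at most one nonzero component is a weight vector. -/
theorem exists_mem_of_comp_unique {x : V}
    (h : ∀ p q, comp hV p x ≠ 0 → comp hV q x ≠ 0 → p = q) (h0 : x ≠ 0) : ∃ p, x ∈ wt p := by
  obtain ⟨p, hp⟩ : ∃ p, comp hV p x ≠ 0 := by
    by_contra! hc
    exact h0 (eq_zero_of_comp_eq_zero hV hc)
  have : x = comp hV p x := eq_of_comp_eq hV fun q => by
    by_cases hq : p = q
    · subst hq
      rw [comp_of_mem hV (comp_mem hV p x)]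
    · rw [comp_of_mem_of_ne hV (comp_mem hV p x) hq]
      by_contra hc
      exact hq (h _ _ hp hc)
  exact ⟨p, this ▸ comp_mem hV p x⟩

theorem comp_coeff_smul (p : MaximalSpectrum R) (r : R) (x : V) :
    comp hV p (ρ r • x) = ρ r • comp hV p x := by
  induction x using weight_induction hV with
  | h0 => simp
  | hw q x hx =>
    by_cases hq : q = p
    · subst hq
      rw [comp_of_mem hV hx, comp_of_mem hV (coeff_smul_mem hx r)]
    · rw [comp_of_mem_of_ne hV hx hq, comp_of_mem_of_ne hV (coeff_smul_mem hx r) hq, smul_zero]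
  | hadd x y hx hy => rw [smul_add, map_add, map_add, smul_add, hx, hy]

/-- The weights occurring in `Xʲ x`, for `x` of weight `p`, all map to `p` under the `j`-th iterate
of `m ↦ σ⁻¹(m)`. -/
theorem pull_iterate_eq_of_comp_X_pow (hσ : IsEssential σ) {p q : MaximalSpectrum R} {x : V}
    (hx : x ∈ wt p) {j : ℕ} (h : comp hV q (𝕏 ^ j • x) ≠ 0) : hσ.pull^[j] q = p := by
  refine (MaximalSpectrum.ext (p.isMaximal.eq_of_le (hσ.pull^[j] q).isMaximal.ne_top
    fun r hr => ?_)).symm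
  rw [hσ.mem_pull_iterate, ← coeff_smul_eq_zero_iff (comp_mem hV q _) h, ← comp_coeff_smul,
    ← X_pow_smul_coeff_smul, hx r hr, smul_zero, map_zero]

theorem pull_eq_of_comp_X (hσ : IsEssential σ) {p q : MaximalSpectrum R} {x : V}
    (hx : x ∈ wt p) (h : comp hV q (𝕏 • x) ≠ 0) : hσ.pull q = p :=
  pull_iterate_eq_of_comp_X_pow hV hσ hx (j := 1) (by rwa [pow_one])

theorem mem_closure_comp (x : V) :
    x ∈ AddSubgroup.closure {y | ∃ p, y = comp hV p x} := by
  classical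
  let := hV.chooseDecomposition
  have h := DirectSum.sum_support_decompose (fun m => weightSpace σ t V m) x
  rw [← h]
  exact AddSubgroup.sum_mem _ fun p _ => AddSubgroup.subset_closure ⟨p, by rw [h]; rfl⟩

/-! ### Generation of simple modules by weight vectors -/

/-- In a simple module, a set `H ⊄ {0}` whose images under `R`, `X` and `Y` lie in its span spans
everything. -/
theorem closure_eq_top [IsSimpleModule (WGWA σ t) V] {H : Set V}
    (hr : ∀ r, ∀ x ∈ H, ρ r • x ∈ AddSubgroup.closure H)
    (hX : ∀ x ∈ H, 𝕏 • x ∈ AddSubgroup.closure H)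
    (hY : ∀ x ∈ H, 𝕐 • x ∈ AddSubgroup.closure H) (h0 : ∃ x ∈ H, x ≠ 0) :
    AddSubgroup.closure H = ⊤ := by
  have key : ∀ a : WGWA σ t, (∀ x ∈ H, a • x ∈ AddSubgroup.closure H) →
      ∀ x ∈ AddSubgroup.closure H, a • x ∈ AddSubgroup.closure H := fun a ha x hx => by
    induction hx using AddSubgroup.closure_induction with
    | mem x hx => exact ha x hx
    | zero => rw [smul_zero]; exact AddSubgroup.zero_mem _
    | add x y _ _ hx hy => rw [smul_add]; exact AddSubgroup.add_mem _ hx hy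
    | neg x _ hx => rw [smul_neg]; exact AddSubgroup.neg_mem _ hx
  obtain ⟨x, hx, hx0⟩ := h0
  exact addSubgroup_eq_top _ (fun r => key _ (hr r)) (key _ hX) (key _ hY)
    ⟨x, AddSubgroup.subset_closure hx, hx0⟩

theorem mem_closure_inter {H : Set V} (hH : ∀ x ∈ H, ∃ p, x ∈ wt p) {x : V}
    (hx : x ∈ AddSubgroup.closure H) (p : MaximalSpectrum R) :
    comp hV p x ∈ AddSubgroup.closure (H ∩ wt p) := by
  induction hx using AddSubgroup.closure_induction with
  | mem x hx =>
    obtain ⟨q, hq⟩ := hH x hx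
    by_cases h : q = p
    · subst h
      rw [comp_of_mem hV hq]
      exact AddSubgroup.subset_closure ⟨hx, hq⟩
    · rw [comp_of_mem_of_ne hV hq h]
      exact AddSubgroup.zero_mem _
  | zero => rw [map_zero]; exact AddSubgroup.zero_mem _
  | add x y _ _ hx hy => rw [map_add]; exact AddSubgroup.add_mem _ hx hy
  | neg x _ hx => rw [map_neg]; exact AddSubgroup.neg_mem _ hx

/-- If a set `H` of weight vectors spans, every weight vector of weight `p` is a sum of elements of
`±H` of weight `p`. -/
theorem mem_closure_inter_of_top (hV : IsWeightModule σ t V) {H : Set V}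
    (hH : ∀ x ∈ H, ∃ p, x ∈ wt p)
    (htop : AddSubgroup.closure H = ⊤) {p : MaximalSpectrum R} {x : V} (hx : x ∈ wt p) :
    x ∈ AddSubgroup.closure (H ∩ wt p) := by
  rw [← comp_of_mem hV hx]
  exact mem_closure_inter hV hH (htop ▸ AddSubgroup.mem_top x) p

theorem exists_mem_inter_of_top (hV : IsWeightModule σ t V) {H : Set V}
    (hH : ∀ x ∈ H, ∃ p, x ∈ wt p)
    (htop : AddSubgroup.closure H = ⊤) {p : MaximalSpectrum R} {x : V} (hx : x ∈ wt p)
    (h0 : x ≠ 0) : ∃ y ∈ H, y ∈ wt p ∧ y ≠ 0 := by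
  by_contra! hc
  have h := mem_closure_inter_of_top hV hH htop hx
  have : AddSubgroup.closure (H ∩ wt p) ≤ ⊥ :=
    (AddSubgroup.closure_le _).2 fun y hy => hc y hy.1 hy.2
  exact h0 (AddSubgroup.mem_bot.1 (this h))

end Components

/-! ### Weights and straight vectors -/

section Weights

variable {R : Type u} [CommRing R] (σ : R →+* R) (t : R)
variable (V : Type v) [AddCommGroup V] [Module (WGWA σ t) V]

/-- `p` is a weight of `V`: the weight space `V_p` is nonzero. -/
def IsWeight (p : MaximalSpectrum R) : Prop := ∃ x ∈ weightSpace σ t V p, x ≠ 0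

variable {V}

/-- A vector is straight if all `Xʲ x` are weight vectors. As `X` may send a weight vector to a sum
of weight vectors of different weights, a weight vector need not be straight. -/
def IsStraight (x : V) : Prop := ∀ j : ℕ, ∃ p, WGWA.X σ t ^ j • x ∈ weightSpace σ t V p

end Weights

section Straight

variable {R : Type u} [CommRing R] {σ : R →+* R} {t : R} (hσ : IsEssential σ)
variable {V : Type v} [AddCommGroup V] [Module (WGWA σ t) V]

local notation "ρ" => WGWA.coeff σ t
local notation "𝕏" => WGWA.X σ t
local notation "𝕐" => WGWA.Y σ t
local notation "wt" => weightSpace σ t V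

theorem exists_isWeight [Nontrivial V] (hV : IsWeightModule σ t V) : ∃ p, IsWeight σ t V p := by
  obtain ⟨x, hx⟩ := exists_ne (0 : V)
  by_contra! hc
  refine hx (eq_zero_of_comp_eq_zero hV fun p => ?_)
  by_contra h
  exact hc p ⟨_, comp_mem hV p x, h⟩

theorem IsStraight.X_pow {x : V} (hx : IsStraight σ t x) (i : ℕ) : IsStraight σ t (𝕏 ^ i • x) :=
  fun j => by
    obtain ⟨p, hp⟩ := hx (j + i)
    exact ⟨p, by rwa [smul_smul, ← pow_add]⟩

theorem IsStraight.Y (hσ : IsEssential σ) {x : V} (hx : IsStraight σ t x) :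
    IsStraight σ t (𝕐 • x) := fun j => by
  cases j with
  | zero =>
    obtain ⟨p, hp⟩ := hx 0
    rw [pow_zero, one_smul] at hp
    exact ⟨_, by simpa using Y_smul_mem hσ hp⟩
  | succ j =>
    obtain ⟨p, hp⟩ := hx j
    exact ⟨p, by
      rw [pow_succ, mul_smul, X_smul_Y_smul, X_pow_smul_coeff_smul]
      exact coeff_smul_mem hp _⟩

theorem IsStraight.Y_pow (hσ : IsEssential σ) {x : V} (hx : IsStraight σ t x) (i : ℕ) :
    IsStraight σ t (𝕐 ^ i • x) := by
  induction i with
  | zero => simpa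
  | succ i ih => rw [pow_succ', mul_smul]; exact ih.Y hσ

variable [IsSimpleModule (WGWA σ t) V]

/-- Any two weights of a simple weight module are images, under iterates of `m ↦ σ⁻¹(m)`, of a
common maximal ideal. Indeed `A` is spanned by the products `Yⁱ r Xˡ`, and the weights of
`Yⁱ r Xˡ x` are as claimed. -/
theorem IsWeight.exists_common {p q : MaximalSpectrum R} (hp : IsWeight σ t V p)
    (hq : IsWeight σ t V q) (hV : IsWeightModule σ t V) :
    ∃ m i l, hσ.pull^[l] m = p ∧ hσ.pull^[i] m = q := by
  let H : Set V := {y | ∃ m i l, ∃ z ∈ wt m, hσ.pull^[l] m = p ∧ y = 𝕐 ^ i • z}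
  have hw : ∀ y ∈ H, ∃ p, y ∈ wt p := by
    rintro y ⟨m, i, l, z, hz, hl, rfl⟩
    exact ⟨_, Y_pow_smul_mem hσ hz i⟩
  have htop : AddSubgroup.closure H = ⊤ := by
    refine closure_eq_top (σ := σ) (t := t) ?_ ?_ ?_ ?_
    · rintro r y ⟨m, i, l, z, hz, hl, rfl⟩
      exact AddSubgroup.subset_closure
        ⟨m, i, l, _, coeff_smul_mem hz _, hl, coeff_smul_Y_pow_smul i r z⟩
    · rintro y ⟨m, i, l, z, hz, hl, rfl⟩
      cases i with
      | zero =>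
        rw [pow_zero, one_smul]
        refine (AddSubgroup.closure_le _).2 ?_ (mem_closure_comp hV (𝕏 • z))
        rintro _ ⟨n, rfl⟩
        by_cases h : comp hV n (𝕏 • z) = 0
        · rw [h]; exact AddSubgroup.zero_mem _
        · refine AddSubgroup.subset_closure ⟨n, 0, l + 1, _, comp_mem hV n (𝕏 • z), ?_, by simp⟩
          rw [Function.iterate_succ_apply, pull_eq_of_comp_X hV hσ hz h, hl]
      | succ i =>
        rw [X_smul_Y_pow_succ_smul]
        exact AddSubgroup.subset_closure
          ⟨m, i, l, _, coeff_smul_mem hz _, hl, coeff_smul_Y_pow_smul i _ z⟩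
    · rintro y ⟨m, i, l, z, hz, hl, rfl⟩
      exact AddSubgroup.subset_closure ⟨m, i + 1, l, z, hz, hl, by rw [pow_succ', mul_smul]⟩
    · obtain ⟨x, hx, hx0⟩ := hp
      exact ⟨x, ⟨p, 0, 0, x, hx, rfl, by simp⟩, hx0⟩
  obtain ⟨x, hx, hx0⟩ := hq
  obtain ⟨y, ⟨m, i, l, z, hz, hl, rfl⟩, hyq, hy0⟩ := exists_mem_inter_of_top hV hw htop hx hx0
  exact ⟨m, i, l, hl, eq_of_mem_of_mem hV (Y_pow_smul_mem hσ hz i) hyq hy0⟩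

/-- If all weights are periodic there is no branching at all. Otherwise, a weight vector `x` whose
weight `q` is not periodic is straight: two distinct weights `p`, `p'` in `Xʲ x` would have a common
ancestor `m`, which would reach `q` in two different numbers of steps. -/
theorem exists_isStraight (hσ : IsEssential σ) (hV : IsWeightModule σ t V) :
    ∃ x : V, x ≠ 0 ∧ IsStraight σ t x := by
  have : Nontrivial V := IsSimpleModule.nontrivial (WGWA σ t) V
  suffices h : ∃ q, IsWeight σ t V q ∧ ∀ p p' j, IsWeight σ t V p → IsWeight σ t V p' →
      hσ.pull^[j] p = q → hσ.pull^[j] p' = q → p = p' by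
    obtain ⟨q, ⟨x, hx, hx0⟩, h⟩ := h
    refine ⟨x, hx0, fun j => ?_⟩
    by_cases h0 : 𝕏 ^ j • x = 0
    · exact ⟨q, h0 ▸ AddSubgroup.zero_mem _⟩
    · exact exists_mem_of_comp_unique hV (fun p p' hp hp' => h p p' j ⟨_, comp_mem hV p _, hp⟩
        ⟨_, comp_mem hV p' _, hp'⟩ (pull_iterate_eq_of_comp_X_pow hV hσ hx hp)
        (pull_iterate_eq_of_comp_X_pow hV hσ hx hp')) h0
  by_cases hper : ∀ p, IsWeight σ t V p → p ∈ Function.periodicPts hσ.pull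
  · obtain ⟨q, hq⟩ := exists_isWeight hV
    exact ⟨q, hq, fun p p' j hp hp' h h' =>
      hσ.pull_iterate_injOn (hper p hp) (hper p' hp') (h.trans h'.symm)⟩
  · push Not at hper
    obtain ⟨q, hq, hnp⟩ := hper
    refine ⟨q, hq, fun p p' j hp hp' h h' => ?_⟩
    obtain ⟨m, i, l, rfl, rfl⟩ := hp.exists_common hσ hp' hV
    rw [← Function.iterate_add_apply] at h h'
    -- A maximal ideal reaching `q` after both `a` and `a + d` steps makes `q` periodic.
    have key : ∀ a d, hσ.pull^[a] m = q → hσ.pull^[a + d] m = q → d = 0 := fun a d h1 h2 => by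
      by_contra hd
      refine hnp (Function.mk_mem_periodicPts (Nat.pos_of_ne_zero hd) ?_)
      rw [add_comm, Function.iterate_add_apply, h1] at h2
      exact h2
    obtain hil | hil := le_total i l
    · obtain ⟨d, rfl⟩ := Nat.exists_eq_add_of_le hil
      have := key (j + i) d h' (by rw [add_assoc]; exact h)
      subst this
      rfl
    · obtain ⟨d, rfl⟩ := Nat.exists_eq_add_of_le hil
      have := key (j + l) d h (by rw [add_assoc]; exact h')
      subst this
      rfl

end Straight

end WGWA

/-! ### Skew Laurent polynomials -/

namespace SkewLaurent

section Coefficients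

variable {k : Type u} [CommRing k] (φ : k ≃+* k)

/-- The monomial `c αⁱ`. -/
noncomputable def monomial (i : ℤ) (c : k) : SkewLaurent k φ :=
  (SkewMonoidAlgebra.single (Multiplicative.ofAdd i) c : SkewMonoidAlgebra k (Multiplicative ℤ))

/-- The coefficient of `αⁱ`. -/
noncomputable def coeff (i : ℤ) (f : SkewLaurent k φ) : k :=
  SkewMonoidAlgebra.coeff (f : SkewMonoidAlgebra k (Multiplicative ℤ)) (Multiplicative.ofAdd i)

variable {φ}

theorem ext {f g : SkewLaurent k φ} (h : ∀ i, coeff φ i f = coeff φ i g) : f = g :=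
  SkewMonoidAlgebra.ext fun i => h i.toAdd

theorem coeff_zero (i : ℤ) : coeff φ i 0 = 0 := rfl

theorem coeff_zero_one : coeff φ 0 1 = 1 := Finsupp.single_eq_same

theorem coeff_sub (i : ℤ) (f g : SkewLaurent k φ) :
    coeff φ i (f - g) = coeff φ i f - coeff φ i g := by
  let := cyclicAction φ
  exact DFunLike.congr_fun (SkewMonoidAlgebra.coeff_sub (k := k) (G := Multiplicative ℤ) f g) _

theorem exists_coeff_ne_zero {f : SkewLaurent k φ} (hf : f ≠ 0) : ∃ i, coeff φ i f ≠ 0 := by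
  by_contra! h
  exact hf (ext h)

theorem coeff_monomial_mul (i n : ℤ) (c : k) (g : SkewLaurent k φ) :
    coeff φ n (monomial φ i c * g) = c * (φ ^ i) (coeff φ (n - i) g) := by
  let := cyclicAction φ
  refine (SkewMonoidAlgebra.coeff_single_mul (k := k) (G := Multiplicative ℤ) c _ g _).trans ?_
  rw [coeff, sub_eq_neg_add]
  rfl

theorem coeff_mul (n : ℤ) (f g : SkewLaurent k φ) :
    coeff φ n (f * g) = Finsupp.sum
      (SkewMonoidAlgebra.coeff (f : SkewMonoidAlgebra k (Multiplicative ℤ)))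
      fun i c => c * (φ ^ i.toAdd) (coeff φ (n - i.toAdd) g) := by
  let := cyclicAction φ
  refine (SkewMonoidAlgebra.coeff_mul_left (k := k) (G := Multiplicative ℤ) f g _).trans ?_
  refine Finsupp.sum_congr fun i _ => ?_
  rw [coeff, sub_eq_neg_add]
  rfl

/-- A nonzero skew Laurent polynomial has a leading monomial. -/
theorem exists_leading {f : SkewLaurent k φ} (hf : f ≠ 0) :
    ∃ n, coeff φ n f ≠ 0 ∧ ∀ i, n < i → coeff φ i f = 0 := by
  let F := SkewMonoidAlgebra.coeff (f : SkewMonoidAlgebra k (Multiplicative ℤ))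
  have hF : (F.support.image Multiplicative.toAdd).Nonempty := by
    obtain ⟨i, hi⟩ := exists_coeff_ne_zero hf
    exact ⟨i, Finset.mem_image.2 ⟨Multiplicative.ofAdd i, Finsupp.mem_support_iff.2 hi, rfl⟩⟩
  refine ⟨(F.support.image Multiplicative.toAdd).max' hF, ?_, fun i hi => ?_⟩
  · obtain ⟨j, hj, h⟩ := Finset.mem_image.1 (Finset.max'_mem _ hF)
    rw [← h]
    exact Finsupp.mem_support_iff.1 hj
  · by_contra h
    refine absurd (Finset.le_max' _ i ?_) (not_le.2 hi)
    exact Finset.mem_image.2 ⟨Multiplicative.ofAdd i, Finsupp.mem_support_iff.2 h, rfl⟩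

theorem exists_lower_bound (f : SkewLaurent k φ) :
    ∃ n, ∀ i, i < n → coeff φ i f = 0 := by
  let F := SkewMonoidAlgebra.coeff (f : SkewMonoidAlgebra k (Multiplicative ℤ))
  obtain ⟨n, hn⟩ := (F.support.image Multiplicative.toAdd).bddBelow
  refine ⟨n, fun i hi => ?_⟩
  by_contra h
  refine absurd (hn ?_) (not_le.2 hi)
  exact Finset.mem_coe.2 (Finset.mem_image.2
    ⟨Multiplicative.ofAdd i, Finsupp.mem_support_iff.2 h, rfl⟩)

theorem mul_ne_zero_of_isField (hk : IsField k) {f g : SkewLaurent k φ} (hf : f ≠ 0) (hg : g ≠ 0) :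
    f * g ≠ 0 := by
  have := hk.isDomain
  obtain ⟨a, ha, ha'⟩ := exists_leading hf
  obtain ⟨b, hb, hb'⟩ := exists_leading hg
  intro h
  have h1 : coeff φ (a + b) (f * g) = coeff φ a f * (φ ^ a) (coeff φ b g) := by
    rw [coeff_mul]
    refine (Finsupp.sum_eq_single (Multiplicative.ofAdd a) (fun i hi hia => ?_) (by simp)).trans ?_
    · have hne : i.toAdd ≠ a := fun h => hia (by rw [← h]; rfl)
      obtain hlt | hlt := lt_or_gt_of_ne hne
      · rw [hb' _ (by lia), map_zero, mul_zero]
      · exact absurd (ha' _ hlt) hi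
    · rw [toAdd_ofAdd, add_sub_cancel_left]
      rfl
  rw [h, coeff_zero] at h1
  exact mul_ne_zero ha ((map_ne_zero_iff _ (φ ^ a).injective).2 hb) h1.symm

/-- Left ideals of a skew Laurent polynomial ring over a field are principal, by division with
remainder. -/
theorem exists_eq_span_singleton (hk : IsField k) (I : Ideal (SkewLaurent k φ)) :
    ∃ f, I = Ideal.span {f} := by
  classical
  by_cases hI : I = ⊥
  · exact ⟨0, by rw [hI]; exact (Ideal.span_singleton_eq_bot.2 rfl).symm⟩
  have hone : ∀ (i n : ℤ) (g : SkewLaurent k φ),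
      coeff φ n (monomial φ i 1 * g) = (φ ^ i) (coeff φ (n - i) g) := fun i n g => by
    rw [coeff_monomial_mul, one_mul]
  have hmono : ∀ i : ℤ, monomial φ (-i) 1 * monomial φ i 1 = 1 := fun i => by
    let := cyclicAction φ
    refine (SkewMonoidAlgebra.single_mul_single (k := k) (G := Multiplicative ℤ)).trans ?_
    rw [smul_one, mul_one, ← ofAdd_add, neg_add_cancel]
    rfl
  -- Multiplying by a power of `α` moves any polynomial into nonnegative degrees.
  have hshift : ∀ g : SkewLaurent k φ, ∃ i : ℤ, ∃ n : ℕ, ∀ j, coeff φ j (monomial φ i 1 * g) ≠ 0 →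
      0 ≤ j ∧ j < n := fun g => by
    by_cases hg : g = 0
    · exact ⟨0, 0, fun j hj => absurd (by rw [hg, mul_zero, coeff_zero]) hj⟩
    obtain ⟨a, ha⟩ := exists_lower_bound g
    obtain ⟨b, -, hb⟩ := exists_leading hg
    refine ⟨-a, (b - a + 1).toNat, fun j hj => ?_⟩
    rw [hone, sub_neg_eq_add, map_ne_zero_iff _ (φ ^ (-a)).injective] at hj
    have h1 := mt (ha (j + a)) hj
    have h2 := mt (hb (j + a)) hj
    lia
  have hex : ∃ n : ℕ, ∃ f ∈ I, f ≠ 0 ∧ ∀ j, coeff φ j f ≠ 0 → 0 ≤ j ∧ j < n := by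
    obtain ⟨g, hg, hg0⟩ := Submodule.exists_mem_ne_zero_of_ne_bot hI
    obtain ⟨i, n, h⟩ := hshift g
    refine ⟨n, _, I.mul_mem_left _ hg, fun h0 => hg0 ?_, h⟩
    rw [← one_mul g, ← hmono i, mul_assoc, h0, mul_zero]
  obtain ⟨f, hfI, hf0, hf⟩ := Nat.find_spec hex
  have hmin := fun m hm => Nat.find_min hex (m := m) hm
  generalize Nat.find hex = N at hf hmin
  obtain ⟨N, rfl⟩ : ∃ M, N = M + 1 := Nat.exists_eq_succ_of_ne_zero fun h => by
    obtain ⟨i, hi⟩ := exists_coeff_ne_zero hf0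
    have := hf i hi
    lia
  have hlead : coeff φ N f ≠ 0 := fun h => hmin N (Nat.lt_succ_self N) ⟨f, hfI, hf0, fun j hj => by
    have h1 := hf j hj
    have h2 : j ≠ N := fun h2 => hj (h2 ▸ h)
    push_cast at h1
    lia⟩
  have hdiv : ∀ n : ℕ, ∀ g ∈ I, (∀ j, coeff φ j g ≠ 0 → 0 ≤ j ∧ j < n) → g ∈ Ideal.span {f} := by
    intro n
    induction n with
    | zero =>
      intro g _ h
      have : g = 0 := ext fun i => by
        by_contra hi
        have := h i hi
        lia
      rw [this]
      exact Ideal.zero_mem _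
    | succ n ih =>
      intro g hg h
      by_cases hnN : n < N
      · have : g = 0 := by
          by_contra h0
          exact hmin (n + 1) (by lia) ⟨g, hg, h0, h⟩
        rw [this]
        exact Ideal.zero_mem _
      · have hlead' : (φ ^ ((n : ℤ) - N)) (coeff φ N f) ≠ 0 :=
          (map_ne_zero_iff _ (φ ^ ((n : ℤ) - N)).injective).2 hlead
        obtain ⟨c, hc⟩ := hk.mul_inv_cancel hlead'
        set q := monomial φ ((n : ℤ) - N) (coeff φ n g * c)
        have hq : g - q * f ∈ Ideal.span {f} := by
          refine ih _ (I.sub_mem hg (I.mul_mem_left _ hfI)) fun j hj => ?_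
          rw [coeff_sub, coeff_monomial_mul] at hj
          have hjn : j ≠ n := by
            rintro rfl
            rw [sub_sub_cancel, mul_assoc, mul_comm c, hc, mul_one, sub_self] at hj
            exact hj rfl
          by_cases hgj : coeff φ j g = 0
          · rw [hgj, zero_sub, neg_ne_zero] at hj
            have hj' : coeff φ (j - (n - N)) f ≠ 0 := fun h0 => hj (by rw [h0, map_zero, mul_zero])
            have := hf _ hj'
            push_cast at this
            lia
          · have := h j hgj
            push_cast at this
            lia
        have := Ideal.add_mem _ hq
          (Ideal.mul_mem_left _ q (Ideal.subset_span (Set.mem_singleton f)))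
        rwa [sub_add_cancel] at this
  refine ⟨f, le_antisymm (fun g hg => ?_) ((Ideal.span_singleton_le_iff_mem I).2 hfI)⟩
  obtain ⟨i, n, h⟩ := hshift g
  have := Ideal.mul_mem_left _ (monomial φ (-i) 1) (hdiv n _ (I.mul_mem_left _ hg) h)
  rwa [← mul_assoc, hmono, one_mul] at this

end Coefficients

section Lift

variable {k : Type u} [CommRing k] {φ : k ≃+* k} {E : Type v} [Ring E]

/-- The ring homomorphism out of `k[α, α⁻¹; φ]` given by a ring homomorphism `ψ` out of `k` and a
unit `a` with `a ψ(c) = ψ(φ(c)) a`. -/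
noncomputable def lift (ψ : k →+* E) (a : Eˣ) (h : ∀ c, (a : E) * ψ c = ψ (φ c) * a) :
    SkewLaurent k φ →+* E :=
  letI := cyclicAction φ
  SkewMonoidAlgebra.liftNCRingHom (k := k) (G := Multiplicative ℤ) ψ
    ((Units.coeHom E).comp (zpowersHom Eˣ a)) <| by
      have key : ∀ (i : ℤ) (c : k),
          ψ ((φ ^ i) c) * ((a ^ i : Eˣ) : E) = ((a ^ i : Eˣ) : E) * ψ c := by
        intro i
        induction i using Int.induction_on with
        | zero => intro c; simp
        | succ i ih =>
          intro c
          rw [zpow_add_one, zpow_add_one, Units.val_mul, mul_assoc, h, ← mul_assoc,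
            ← mul_assoc, ← ih]
          rfl
        | pred i ih =>
          intro c
          have h' : ∀ c, ψ (φ⁻¹ c) * ((a⁻¹ : Eˣ) : E) = ((a⁻¹ : Eˣ) : E) * ψ c := fun c => by
            rw [Units.mul_inv_eq_iff_eq_mul, mul_assoc, Units.eq_inv_mul_iff_mul_eq, h]
            congr 2
            exact φ.apply_symm_apply c
          rw [zpow_sub_one, zpow_sub_one, Units.val_mul, mul_assoc, ← h', ← mul_assoc,
            ← mul_assoc, ← ih]
          rfl
      exact fun {c i} => key i.toAdd c

theorem lift_C (ψ : k →+* E) (a : Eˣ) (h : ∀ c, (a : E) * ψ c = ψ (φ c) * a) (c : k) :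
    lift ψ a h (C φ c) = ψ c := by
  let := cyclicAction φ
  refine (SkewMonoidAlgebra.liftNC_single (k := k) (G := Multiplicative ℤ) _ _ _ _).trans ?_
  simp

theorem lift_α (ψ : k →+* E) (a : Eˣ) (h : ∀ c, (a : E) * ψ c = ψ (φ c) * a) :
    lift ψ a h (α φ) = a := by
  let := cyclicAction φ
  refine (SkewMonoidAlgebra.liftNC_single (k := k) (G := Multiplicative ℤ) _ _ _ _).trans ?_
  simp

/-- `1 + α` has no left inverse: it kills `1` in the module `k` on which `α` acts as `-φ`. -/
theorem mul_one_add_α_ne_one [Nontrivial k] (p : SkewLaurent k φ) :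
    p * (1 + (α φ : SkewLaurent k φ)) ≠ 1 := by
  let T : (AddMonoid.End k)ˣ :=
    { val := -φ.toAddEquiv.toAddMonoidHom
      inv := -φ.symm.toAddEquiv.toAddMonoidHom
      val_inv := AddMonoidHom.ext fun x => by
        change -φ (-φ.symm x) = x
        simp
      inv_val := AddMonoidHom.ext fun x => by
        change -φ.symm (-φ x) = x
        simp }
  let Φ : SkewLaurent k φ →+* AddMonoid.End k := lift (Module.toAddMonoidEnd k k) T fun c =>
    AddMonoidHom.ext fun x => by
      change -φ (c * x) = φ c * -φ x
      simp
  intro h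
  have h1 : Φ (p * (1 + (α φ : SkewLaurent k φ))) 1 = Φ 1 1 := by rw [h]
  have hα : Φ (α φ) = T := lift_α _ _ _
  rw [map_mul Φ, map_add Φ, map_one Φ, hα] at h1
  change Φ p (1 + -φ 1) = 1 at h1
  rw [map_one, add_neg_cancel, map_zero] at h1
  exact zero_ne_one h1

end Lift

end SkewLaurent

/-! ### Simple modules over skew Laurent polynomial rings -/

namespace SkewLaurent

/-- In a nonzero simple module over `k[α, α⁻¹; φ]`, `k` a field, the annihilator of a nonzero
vector `x` is generated by an irreducible element. It is nonzero because otherwise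
`x = p (1 + α) x` for some `p` would make `1 + α` left invertible. -/
theorem exists_irreducible_annihilator {k : Type u} [CommRing k] (hk : IsField k) {φ : k ≃+* k}
    {W : Type v} [AddCommGroup W] (Φ : SkewLaurent k φ →+* AddMonoid.End W)
    (hW : ∀ x, x ≠ 0 → ∀ y, ∃ p, Φ p x = y) {x : W} (hx : x ≠ 0) :
    ∃ f, Irreducible f ∧ ∀ p, Φ p x = 0 ↔ p ∈ Ideal.span {f} := by
  have := hk.nontrivial
  let I : Ideal (SkewLaurent k φ) :=
    { carrier := {p | Φ p x = 0}
      zero_mem' := by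
        change Φ 0 x = 0
        rw [map_zero Φ]; rfl
      add_mem' := fun {p q} hp hq => by
        change Φ (p + q) x = 0
        rw [map_add Φ]
        change Φ p x + Φ q x = 0
        rw [show Φ p x = 0 from hp, show Φ q x = 0 from hq, add_zero]
      smul_mem' := fun p q hq => by
        change Φ (p * q) x = 0
        rw [map_mul Φ]
        change Φ p (Φ q x) = 0
        rw [show Φ q x = 0 from hq, map_zero] }
  obtain ⟨f, hf⟩ := exists_eq_span_singleton hk I
  have hI : ∀ p, Φ p x = 0 ↔ p ∈ Ideal.span {f} := fun p => by rw [← hf]; rfl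
  have hmul : ∀ p q : SkewLaurent k φ, Φ (p * q) x = Φ p (Φ q x) := fun p q => by
    rw [map_mul Φ]; rfl
  -- If `b x ≠ 0`, then `b` is left invertible modulo the annihilator.
  have hinv : ∀ b, Φ b x ≠ 0 → ∃ c, c * b - 1 ∈ Ideal.span {f} := fun b hb => by
    obtain ⟨c, hc⟩ := hW _ hb x
    refine ⟨c, (hI _).1 ?_⟩
    rw [map_sub Φ, map_one Φ]
    change Φ (c * b) x - x = 0
    rw [hmul, hc, sub_self]
  have hfx : Φ f x = 0 := (hI f).2 (Ideal.subset_span (Set.mem_singleton f))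
  have hf0 : f ≠ 0 := by
    rintro rfl
    rw [Ideal.span_singleton_eq_bot.2 rfl] at hI hinv
    have h1 : Φ (1 + (α φ : SkewLaurent k φ)) x ≠ 0 := fun h => by
      have h3 := (hI _).1 h
      rw [Ideal.mem_bot] at h3
      have h4 : (1 : SkewLaurent k φ) = -(α φ : SkewLaurent k φ) := eq_neg_of_add_eq_zero_left h3
      -- The constant coefficient of `1 + α` is `1`.
      have h5 := congrArg (coeff φ 0) h4
      have h6 : coeff φ 0 (-(α φ : SkewLaurent k φ)) = 0 := by
        rw [← zero_sub, coeff_sub, coeff_zero, zero_sub, neg_eq_zero]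
        exact Finsupp.single_eq_of_ne (by decide)
      rw [h6, coeff_zero_one] at h5
      exact one_ne_zero h5
    obtain ⟨c, hc⟩ := hinv _ h1
    exact mul_one_add_α_ne_one c (sub_eq_zero.1 ((Ideal.mem_bot).1 hc))
  -- One-sided inverses are two-sided, as there are no zero divisors.
  have hunit : ∀ b c : SkewLaurent k φ, c * b = 1 → IsUnit b ∧ IsUnit c := fun b c h => by
    have hb : b ≠ 0 := by
      rintro rfl
      rw [mul_zero] at h
      have := coeff_zero_one (φ := φ)
      rw [← h, coeff_zero] at this
      exact zero_ne_one this
    have h' : b * c = 1 := by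
      by_contra hbc
      refine mul_ne_zero_of_isField hk (sub_ne_zero.2 hbc) hb ?_
      rw [sub_mul, mul_assoc, h, mul_one, one_mul, sub_self]
    exact ⟨⟨⟨b, c, h', h⟩, rfl⟩, ⟨⟨c, b, h, h'⟩, rfl⟩⟩
  refine ⟨f, ⟨fun hu => hx ?_, fun a b hab => ?_⟩, hI⟩
  · obtain ⟨u, rfl⟩ := hu
    have := hmul ((u⁻¹ : (SkewLaurent k φ)ˣ) : SkewLaurent k φ) u
    rw [hfx, map_zero, Units.inv_mul, map_one Φ] at this
    exact this
  · by_cases hb : Φ b x = 0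
    · obtain ⟨c, hc⟩ := Ideal.mem_span_singleton'.1 ((hI b).1 hb)
      have hb0 : b ≠ 0 := by
        rintro rfl
        rw [mul_zero] at hab
        exact hf0 hab
      refine Or.inl (hunit a c ?_).1
      by_contra hca
      refine mul_ne_zero_of_isField hk (sub_ne_zero.2 hca) hb0 ?_
      rw [sub_mul, mul_assoc, ← hab, hc, one_mul, sub_self]
    · obtain ⟨c, hc⟩ := hinv b hb
      obtain ⟨q, hq⟩ := Ideal.mem_span_singleton'.1 hc
      refine Or.inr (hunit b (c - q * a) ?_).1
      rw [sub_mul, mul_assoc, ← hab, hq]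
      abel

end SkewLaurent

/-! ### Periodic chains -/

namespace PeriodicChain

section

variable {R : Type u} [CommRing R] {σ : R →+* R} {n : ℕ} (m : PeriodicChain σ n)
  (hσ : IsEssential σ)

theorem pull_ideal (i : ℤ) : hσ.pull (m.ideal (i + 1)) = m.ideal i := hσ.pull_eq_of_le (m.step i)

theorem pull_iterate_ideal (j : ℕ) (i : ℤ) : hσ.pull^[j] (m.ideal i) = m.ideal (i - j) := by
  induction j with
  | zero => simp
  | succ j ih =>
    have h := m.pull_ideal hσ (i - j - 1)
    rw [sub_add_cancel] at h
    rw [Function.iterate_succ_apply', ih, h, Nat.cast_succ, sub_add_eq_sub_sub]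

theorem periodic_mul (i : ℤ) (a : ℕ) : m.ideal (i + (n + 1 : ℕ) * a) = m.ideal i := by
  induction a with
  | zero => simp
  | succ a ih => rw [← ih, ← m.periodic (i + (n + 1 : ℕ) * a)]; congr 1; push_cast; ring

/-- Within one period the ideals of the chain are distinct. -/
theorem le_of_ideal_eq (hσ : IsEssential σ) {i : ℤ} {d : ℕ} (hd : 0 < d)
    (h : m.ideal (i + d) = m.ideal i) : n + 1 ≤ d := by
  refine m.minimal d hd fun j => ?_
  -- Move `j` below `i` by full periods, then apply `m ↦ σ⁻¹(m)` to `h`.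
  have h1 : m.ideal (j - (n + 1 : ℕ) * (j - i).toNat + d) =
      m.ideal (j - (n + 1 : ℕ) * (j - i).toNat) := by
    obtain ⟨e, he⟩ : ∃ e : ℕ, j - (n + 1 : ℕ) * (j - i).toNat = i - e :=
      ⟨(i - (j - (n + 1 : ℕ) * (j - i).toNat)).toNat, by
        have : (0 : ℤ) ≤ n * (j - i).toNat := by positivity
        push_cast
        lia⟩
    have h2 := congrArg hσ.pull^[e] h
    rw [m.pull_iterate_ideal, m.pull_iterate_ideal] at h2
    rw [he, ← h2]
    congr 1
    ring
  rw [← m.periodic_mul (j - (n + 1 : ℕ) * (j - i).toNat) (j - i).toNat, sub_add_cancel,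
    ← m.periodic_mul (j - (n + 1 : ℕ) * (j - i).toNat + d) (j - i).toNat] at h1
  rw [← h1]
  congr 1
  ring

/-- The periodic chain through a periodic point of `m ↦ σ⁻¹(m)`. -/
def ofPeriodic (q : MaximalSpectrum R) (hq : Function.minimalPeriod hσ.pull q = n + 1) :
    PeriodicChain σ n where
  ideal i := hσ.pull^[((-i) % (n + 1 : ℕ)).toNat] q
  step i := by
    -- Both sides are iterates of `q` whose exponents agree modulo the period.
    have h0 : ((n + 1 : ℕ) : ℤ) ≠ 0 := by positivity
    have hmod : ((-(i + 1)) % (n + 1 : ℕ)).toNat.succ % (n + 1) =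
        ((-i) % (n + 1 : ℕ)).toNat % (n + 1) := by
      refine Nat.cast_injective (R := ℤ) ?_
      rw [Int.natCast_mod, Int.natCast_mod, Nat.cast_succ,
        Int.toNat_of_nonneg (Int.emod_nonneg _ h0), Int.toNat_of_nonneg (Int.emod_nonneg _ h0),
        Int.emod_add_emod, Int.emod_emod]
      congr 1
      ring
    have h : hσ.pull (hσ.pull^[((-(i + 1)) % (n + 1 : ℕ)).toNat] q) =
        hσ.pull^[((-i) % (n + 1 : ℕ)).toNat] q := by
      rw [← Function.iterate_succ_apply' (f := hσ.pull),
        ← Function.iterate_mod_minimalPeriod_eq (n := Nat.succ _), hq, hmod, ← hq,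
        Function.iterate_mod_minimalPeriod_eq]
    rw [← h]
    exact le_rfl
  periodic i := by
    congr 2
    rw [neg_add, ← sub_eq_add_neg, Int.sub_emod_right]
  minimal l hl h := by
    have h1 := h (-l)
    rw [neg_add_cancel, neg_zero, neg_neg, Int.zero_emod, ← Int.natCast_mod, Int.toNat_natCast,
      ← hq, Function.iterate_mod_minimalPeriod_eq] at h1
    rw [← hq]
    exact Function.IsPeriodicPt.minimalPeriod_le hl h1.symm

theorem ofPeriodic_ideal_zero (q : MaximalSpectrum R)
    (hq : Function.minimalPeriod hσ.pull q = n + 1) : (ofPeriodic hσ q hq).ideal 0 = q := by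
  simp [ofPeriodic]

end

end PeriodicChain

/-! ### Homomorphisms out of band modules -/

namespace WGWA

section Band

variable {R : Type u} [CommRing R] {σ : R →+* R} {t : R} (hσ : IsEssential σ) {n : ℕ}
variable {V : Type v} [AddCommGroup V] [Module (WGWA σ t) V] (m : PeriodicChain σ n)

local notation "ρ" => WGWA.coeff σ t
local notation "𝕏" => WGWA.X σ t
local notation "𝕐" => WGWA.Y σ t
local notation "wt" => weightSpace σ t V

theorem coeff_smul_bandModuleM (f : m.P hσ) (r : R) (w : BandModuleM hσ t m f) :
    ρ r • w = BandModuleM.opR hσ t m f r w := by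
  exact DFunLike.congr_fun (lift_coeff ..) w

theorem Y_smul_bandModuleM (f : m.P hσ) (w : BandModuleM hσ t m f) :
    𝕐 • w = BandModuleM.equivY hσ t m f w := by
  exact DFunLike.congr_fun (lift_Y ..) w

theorem coeff_smul_bandModuleN (f : m.P hσ) (r : R) (w : BandModuleN hσ t m f) :
    ρ r • w = BandModuleN.opR hσ t m f r w := by
  exact DFunLike.congr_fun (lift_coeff ..) w

theorem X_smul_bandModuleN (f : m.P hσ) (w : BandModuleN hσ t m f) :
    𝕏 • w = BandModuleN.equivX hσ t m f w := by
  exact DFunLike.congr_fun (lift_X ..) w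

variable {m}

/-- A homomorphism `θ : L_f → V_{m_0}` under which `α` is inverse to `Yⁿ⁺¹` extends to `M^f → V`. -/
theorem exists_bandModuleM_hom {f : m.P hσ} (θ : m.L hσ f →+ V)
    (hC : ∀ r x, θ (SkewLaurent.C (m.sigmaBar hσ) (Ideal.Quotient.mk _ r) • x) = ρ r • θ x)
    (hα : ∀ x, 𝕐 ^ (n + 1) • θ x =
      θ ((((SkewLaurent.α (m.sigmaBar hσ))⁻¹ : (m.P hσ)ˣ) : m.P hσ) • x)) :
    ∃ F : BandModuleM hσ t m f →ₗ[WGWA σ t] V,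
      ∀ w, F w = ∑ i : Fin (n + 1), 𝕐 ^ (i : ℕ) • θ (w i) := by
  let F : BandModuleM hσ t m f →+ V :=
    { toFun := fun w => ∑ i : Fin (n + 1), 𝕐 ^ (i : ℕ) • θ (w i)
      map_zero' := Finset.sum_eq_zero fun i _ => by
        change 𝕐 ^ (i : ℕ) • θ 0 = 0
        rw [map_zero, smul_zero]
      map_add' := fun w w' => by
        rw [← Finset.sum_add_distrib]
        refine Finset.sum_congr rfl fun i _ => ?_
        change 𝕐 ^ (i : ℕ) • θ (w i + w' i) = _
        rw [map_add, smul_add] }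
  have hF : ∀ w, F w = ∑ i : Fin (n + 1), 𝕐 ^ (i : ℕ) • θ (w i) := fun w => rfl
  have hr : ∀ r w, F (ρ r • w) = ρ r • F w := fun r w => by
    rw [coeff_smul_bandModuleM, hF, hF, Finset.smul_sum]
    refine Finset.sum_congr rfl fun i _ => ?_
    change 𝕐 ^ (i : ℕ) • θ (BandModuleM.scalar hσ m i r • w i) = _
    rw [BandModuleM.scalar_apply, hC, coeff_smul_Y_pow_smul]
  have hY : ∀ w, F (𝕐 • w) = 𝕐 • F w := fun w => by
    rw [Y_smul_bandModuleM, hF, hF, Finset.smul_sum, Fin.sum_univ_succ, Fin.sum_univ_castSucc,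
      add_comm]
    congr 1
    · refine Finset.sum_congr rfl fun i _ => ?_
      change 𝕐 ^ (i.succ : ℕ) • θ (w i.castSucc) = _
      rw [smul_smul, ← pow_succ', Fin.val_succ, Fin.val_castSucc]
    · change 𝕐 ^ ((0 : Fin (n + 1)) : ℕ) • θ ((((SkewLaurent.α (m.sigmaBar hσ))⁻¹ : (m.P hσ)ˣ) :
        m.P hσ) • w (Fin.last n)) = _
      rw [smul_smul, ← pow_succ', Fin.val_last, hα, Fin.val_zero, pow_zero, one_smul]
  refine ⟨linearMapOf F hr (fun w => ?_) hY, hF⟩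
  obtain ⟨w, rfl⟩ := (BandModuleM.equivY hσ t m f).surjective w
  rw [← Y_smul_bandModuleM, X_smul_Y_smul, hr, hY, X_smul_Y_smul]

/-- A homomorphism `θ : L_f → V_{m_0}` under which `α` corresponds to `Xⁿ⁺¹` extends to
`N^f → V`. -/
theorem exists_bandModuleN_hom {f : m.P hσ} (θ : m.L hσ f →+ V)
    (hX : ∀ (i : ℕ) x, i ≤ n → 𝕏 ^ i • θ x ∈ wt (m.ideal i))
    (hC : ∀ r x, θ (SkewLaurent.C (m.sigmaBar hσ) (Ideal.Quotient.mk _ r) • x) = ρ r • θ x)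
    (hα : ∀ x, 𝕏 ^ (n + 1) • θ x = θ ((SkewLaurent.α (m.sigmaBar hσ) : m.P hσ) • x)) :
    ∃ F : BandModuleN hσ t m f →ₗ[WGWA σ t] V,
      ∀ w, F w = ∑ i : Fin (n + 1), 𝕏 ^ (i : ℕ) • θ (w i) := by
  let F : BandModuleN hσ t m f →+ V :=
    { toFun := fun w => ∑ i : Fin (n + 1), 𝕏 ^ (i : ℕ) • θ (w i)
      map_zero' := Finset.sum_eq_zero fun i _ => by
        change 𝕏 ^ (i : ℕ) • θ 0 = 0
        rw [map_zero, smul_zero]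
      map_add' := fun w w' => by
        rw [← Finset.sum_add_distrib]
        refine Finset.sum_congr rfl fun i _ => ?_
        change 𝕏 ^ (i : ℕ) • θ (w i + w' i) = _
        rw [map_add, smul_add] }
  have hF : ∀ w, F w = ∑ i : Fin (n + 1), 𝕏 ^ (i : ℕ) • θ (w i) := fun w => rfl
  have hr : ∀ r w, F (ρ r • w) = ρ r • F w := fun r w => by
    rw [coeff_smul_bandModuleN, hF, hF, Finset.smul_sum]
    refine Finset.sum_congr rfl fun i _ => ?_
    change 𝕏 ^ (i : ℕ) • θ (BandModuleN.scalar hσ m i r • w i) = _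
    obtain ⟨s, hs⟩ := hσ.exists_pow_sub_mem (i : ℕ) (m.ideal (i : ℕ)) r
    rw [BandModuleN.scalar_apply hσ m i r s hs, hC, X_pow_smul_coeff_smul,
      coeff_smul_congr (hX i (w i) (Nat.lt_succ_iff.1 i.2)) hs]
  have hX' : ∀ w, F (𝕏 • w) = 𝕏 • F w := fun w => by
    rw [X_smul_bandModuleN, hF, hF, Finset.smul_sum, Fin.sum_univ_succ, Fin.sum_univ_castSucc,
      add_comm]
    congr 1
    · refine Finset.sum_congr rfl fun i _ => ?_
      change 𝕏 ^ (i.succ : ℕ) • θ (w i.castSucc) = _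
      rw [smul_smul, ← pow_succ', Fin.val_succ, Fin.val_castSucc]
    · change 𝕏 ^ ((0 : Fin (n + 1)) : ℕ) • θ ((SkewLaurent.α (m.sigmaBar hσ) : m.P hσ) •
        w (Fin.last n)) = _
      rw [smul_smul, ← pow_succ', Fin.val_last, hα, Fin.val_zero, pow_zero, one_smul]
  refine ⟨linearMapOf F hr hX' (fun w => ?_), hF⟩
  obtain ⟨w, rfl⟩ := (BandModuleN.equivX hσ t m f).surjective w
  rw [← X_smul_bandModuleN, Y_smul_X_smul, hr, hX', Y_smul_X_smul]

end Band

/-! ### Recognition of band modules -/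

section Band

variable {R : Type u} [CommRing R] {σ : R →+* R} {t : R} (hσ : IsEssential σ) {n : ℕ}
variable {V : Type v} [AddCommGroup V] [Module (WGWA σ t) V]

local notation "ρ" => WGWA.coeff σ t
local notation "𝕏" => WGWA.X σ t
local notation "𝕐" => WGWA.Y σ t
local notation "wt" => weightSpace σ t V

variable (σ t V) in
/-- The action of the residue field `R / p` on the weight space `V_p`. -/
noncomputable def residueAction (p : MaximalSpectrum R) :
    R ⧸ p.asIdeal →+* AddMonoid.End (weightSpace σ t V p) :=
  Ideal.Quotient.lift p.asIdeal
    (RingHom.mk'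
      { toFun := fun r =>
          { toFun := fun x => ⟨WGWA.coeff σ t r • (x : V), coeff_smul_mem x.2 r⟩
            map_zero' := Subtype.ext (smul_zero _)
            map_add' := fun x y => Subtype.ext (smul_add _ _ _) }
        map_one' := AddMonoidHom.ext fun x => Subtype.ext (by
          change WGWA.coeff σ t 1 • (x : V) = x
          rw [map_one, one_smul])
        map_mul' := fun r s => AddMonoidHom.ext fun x => Subtype.ext (coeff_mul_smul r s _) }
      (fun r s => AddMonoidHom.ext fun x => Subtype.ext (by
        change WGWA.coeff σ t (r + s) • (x : V) = _
        rw [map_add, add_smul]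
        rfl)))
    (fun r hr => AddMonoidHom.ext fun x => Subtype.ext (x.2 r hr))

/-- Let `T` be an additive automorphism of `V_{m_0}` with `T r = σⁿ⁺¹(r) T`. Letting `α` act as `T`
makes `V_{m_0}` a module over `P = k[α, α⁻¹; σ̄]`. If it is simple, every nonzero vector of it is
the image of `1` under an injective homomorphism from `L_f` with `f` irreducible. -/
theorem exists_hom_of_semilinear (m : PeriodicChain σ n) (T : wt (m.ideal 0) ≃+ wt (m.ideal 0))
    (hT : ∀ r (x y : wt (m.ideal 0)), (y : V) = ρ r • (x : V) →
      (T y : V) = ρ ((σ ^ (n + 1)) r) • (T x : V)) :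
    ∃ Φ : m.P hσ →+* AddMonoid.End (wt (m.ideal 0)),
      (∀ f x, (∀ p ∈ Ideal.span {f}, Φ p x = 0) → ∃ θ : m.L hσ f →+ V,
        (∀ p, θ (Submodule.Quotient.mk p) = Φ p x) ∧
        (∀ y, θ y ∈ wt (m.ideal 0)) ∧
        (∀ r y, θ (SkewLaurent.C (m.sigmaBar hσ) (Ideal.Quotient.mk _ r) • y) = ρ r • θ y) ∧
        (∀ y (h : θ y ∈ wt (m.ideal 0)),
          θ ((SkewLaurent.α (m.sigmaBar hσ) : m.P hσ) • y) = T ⟨θ y, h⟩)) := by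
  let a : (AddMonoid.End (wt (m.ideal 0)))ˣ :=
    { val := T.toAddMonoidHom
      inv := T.symm.toAddMonoidHom
      val_inv := AddMonoidHom.ext fun x => T.apply_symm_apply x
      inv_val := AddMonoidHom.ext fun x => T.symm_apply_apply x }
  have ha : ∀ c, (a : AddMonoid.End (wt (m.ideal 0))) * residueAction σ t V _ c =
      residueAction σ t V _ (m.sigmaBar hσ c) * a := fun c => by
    obtain ⟨r, rfl⟩ := Ideal.Quotient.mk_surjective c
    rw [m.sigmaBar_mk]
    exact AddMonoidHom.ext fun x => Subtype.ext (hT r x _ rfl)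
  let Φ : m.P hσ →+* AddMonoid.End (wt (m.ideal 0)) :=
    SkewLaurent.lift (residueAction σ t V (m.ideal 0)) a ha
  have hΦC : ∀ c, Φ (SkewLaurent.C (m.sigmaBar hσ) c) = residueAction σ t V _ c :=
    SkewLaurent.lift_C _ _ _
  have hΦα : Φ (SkewLaurent.α (m.sigmaBar hσ)) = a := SkewLaurent.lift_α _ _ _
  refine ⟨Φ, fun f x hf => ?_⟩
  let θ : m.L hσ f →+ V := (weightSpace σ t V (m.ideal 0)).subtype.comp
    (QuotientAddGroup.lift (Ideal.span {f} : Ideal (m.P hσ)).toAddSubgroup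
      ((AddMonoidHom.eval x).comp Φ.toAddMonoidHom) hf)
  have hθ : ∀ p, θ (Submodule.Quotient.mk p) = Φ p x := fun p => rfl
  have hmul : ∀ p q, Φ (p * q) x = Φ p (Φ q x) := fun p q => by rw [map_mul Φ]; rfl
  refine ⟨θ, hθ, fun y => ?_, fun r y => ?_, fun y h => ?_⟩
  · obtain ⟨p, rfl⟩ := Submodule.Quotient.mk_surjective _ y
    exact (Φ p x).2
  · obtain ⟨p, rfl⟩ := Submodule.Quotient.mk_surjective _ y
    rw [← Submodule.Quotient.mk_smul, hθ, hθ, smul_eq_mul, hmul, hΦC]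
    rfl
  · obtain ⟨p, rfl⟩ := Submodule.Quotient.mk_surjective _ y
    rw [← Submodule.Quotient.mk_smul, hθ, smul_eq_mul, hmul, hΦα]
    rfl

/-- The component of a sum of vectors from distinct weight spaces. -/
theorem comp_sum (hV : IsWeightModule σ t V) {ι : Type*} [Fintype ι]
    {p : ι → MaximalSpectrum R} (hp : Function.Injective p) {x : ι → V}
    (hx : ∀ i, x i ∈ wt (p i)) (i : ι) : comp hV (p i) (∑ j, x j) = x i := by
  rw [map_sum, Finset.sum_eq_single i (fun j _ hj => comp_of_mem_of_ne hV (hx j)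
    fun h => hj (hp h)) (fun h => absurd (Finset.mem_univ i) h), comp_of_mem hV (hx i)]

/-- The common part of the two recognition results for band modules: `B f` stands for `M^f` or
`N^f`, and `g i` for `Yⁱ` or `Xⁱ`. As `V` is simple, all homomorphisms `B 0 → V` obtained from
nonzero vectors of `V_{m_0}` are surjective, so `V_{m_0}` is a simple `P`-module. -/
theorem exists_linearEquiv_of_hom [IsSimpleModule (WGWA σ t) V] (hV : IsWeightModule σ t V)
    (m : PeriodicChain σ n) (hne : IsWeight σ t V (m.ideal 0))
    (Φ : m.P hσ →+* AddMonoid.End (wt (m.ideal 0))) {B : m.P hσ → Type u}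
    [∀ f, AddCommGroup (B f)] [∀ f, Module (WGWA σ t) (B f)]
    (e : ∀ f, B f ≃+ (Fin (n + 1) → m.L hσ f))
    (g : Fin (n + 1) → WGWA σ t) (hg0 : g 0 = 1) {p : Fin (n + 1) → MaximalSpectrum R}
    (hp : Function.Injective p) (hp0 : p 0 = m.ideal 0)
    (hgp : ∀ i, ∀ x ∈ wt (m.ideal 0), g i • x ∈ wt (p i))
    (hg : ∀ i, ∀ x ∈ wt (m.ideal 0), g i • x = 0 → x = 0)
    (hB : ∀ f x, (∀ q ∈ Ideal.span {f}, Φ q x = 0) → ∃ F : B f →ₗ[WGWA σ t] V,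
      ∀ q : Fin (n + 1) → m.P hσ, F ((e f).symm fun i => Submodule.Quotient.mk (q i)) =
        ∑ i, g i • (Φ (q i) x : V)) :
    ∃ f, Irreducible f ∧ Nonempty (V ≃ₗ[WGWA σ t] B f) := by
  have hlift : ∀ f (w : B f), ∃ q : Fin (n + 1) → m.P hσ,
      w = (e f).symm fun i => Submodule.Quotient.mk (q i) := fun f w => by
    choose q hq using fun i => Submodule.Quotient.mk_surjective (Ideal.span {f}) (e f w i)
    exact ⟨q, ((e f).eq_symm_apply).2 (funext fun i => (hq i).symm)⟩
  have hcomp : ∀ (q : Fin (n + 1) → m.P hσ) x i,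
      comp hV (p i) (∑ i, g i • (Φ (q i) x : V)) = g i • (Φ (q i) x : V) := fun q x i =>
    comp_sum hV hp (fun i => hgp i _ (Φ (q i) x).2) i
  have hsurj : ∀ f x, x ≠ 0 → ∀ F : B f →ₗ[WGWA σ t] V,
      (∀ q : Fin (n + 1) → m.P hσ, F ((e f).symm fun i => Submodule.Quotient.mk (q i)) =
        ∑ i, g i • (Φ (q i) x : V)) → Function.Surjective F := fun f x hx F hF => by
    refine F.surjective_of_ne_zero fun h => hx (Subtype.ext ?_)
    have h1 := hcomp (fun _ => 1) x 0
    rw [← hF, h, LinearMap.zero_apply, map_zero, hg0, one_smul, map_one Φ] at h1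
    exact h1.symm
  have hW : ∀ x, x ≠ 0 → ∀ y, ∃ q, Φ q x = y := fun x hx y => by
    obtain ⟨F, hF⟩ := hB 0 x fun q hq => by
      rw [Ideal.span_singleton_eq_bot.2 rfl, Ideal.mem_bot] at hq
      rw [hq, map_zero Φ]
      rfl
    obtain ⟨w, hw⟩ := hsurj 0 x hx F hF y
    obtain ⟨q, rfl⟩ := hlift 0 w
    have h := hcomp q x 0
    rw [← hF, hw, hp0, comp_of_mem hV y.2, hg0, one_smul] at h
    exact ⟨q 0, Subtype.ext h.symm⟩
  obtain ⟨x, hx, hx0⟩ := hne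
  obtain ⟨f, hf, hfx⟩ := SkewLaurent.exists_irreducible_annihilator
    ((Ideal.Quotient.maximal_ideal_iff_isField_quotient _).1 (m.ideal 0).isMaximal) Φ hW
    (x := ⟨x, hx⟩) fun h => hx0 (congrArg Subtype.val h)
  obtain ⟨F, hF⟩ := hB f ⟨x, hx⟩ fun q hq => (hfx q).2 hq
  refine ⟨f, hf, ⟨(LinearEquiv.ofBijective F ⟨(injective_iff_map_eq_zero F).2 fun w hw => ?_,
    hsurj f _ (fun h => hx0 (congrArg Subtype.val h)) F hF⟩).symm⟩⟩
  obtain ⟨q, rfl⟩ := hlift f w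
  rw [hF] at hw
  rw [AddEquiv.map_eq_zero_iff]
  funext i
  refine (Submodule.Quotient.mk_eq_zero _).2 ((hfx _).1 (Subtype.ext (hg i _ (Φ (q i) _).2 ?_)))
  rw [← hcomp, hw, map_zero]

variable [IsSimpleModule (WGWA σ t) V]

/-- If `Yⁿ⁺¹` is bijective on `V_{m_0} ≠ 0`, where `n + 1` is the period of `m_0`, then `V ≅ M^f`
for some irreducible `f`. -/
theorem isBandModule_of_Y_pow (hV : IsWeightModule σ t V) (m : PeriodicChain σ n)
    (hne : IsWeight σ t V (m.ideal 0))
    (hinj : ∀ x ∈ wt (m.ideal 0), 𝕐 ^ (n + 1) • x = 0 → x = 0)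
    (hsurj : ∀ x ∈ wt (m.ideal 0), ∃ y ∈ wt (m.ideal 0), 𝕐 ^ (n + 1) • y = x) :
    IsBandModule hσ t V := by
  have hmem : ∀ (i : ℕ), ∀ x ∈ wt (m.ideal 0), 𝕐 ^ i • x ∈ wt (m.ideal (-i)) := fun i x hx => by
    have := Y_pow_smul_mem hσ hx i
    rwa [m.pull_iterate_ideal, zero_sub] at this
  have hper : m.ideal (-(n + 1 : ℕ)) = m.ideal 0 := by
    rw [← m.periodic, neg_add_cancel]
  have hinjm : Function.Injective fun i : Fin (n + 1) => m.ideal (-((i : ℕ) : ℤ)) := by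
    have key : ∀ i j : ℕ, i < j → j < n + 1 → m.ideal (-(i : ℤ)) ≠ m.ideal (-(j : ℤ)) := by
      intro i j hij hj h
      have := m.le_of_ideal_eq hσ (i := -(j : ℤ)) (d := j - i) (by lia) (by
        rw [← h]; congr 1; lia)
      lia
    intro i j h
    by_contra hne
    obtain hlt | hlt := lt_or_gt_of_ne (Fin.val_ne_of_ne hne)
    · exact key _ _ hlt j.2 h
    · exact key _ _ hlt i.2 h.symm
  let S : wt (m.ideal 0) →+ wt (m.ideal 0) :=
    { toFun := fun x => ⟨𝕐 ^ (n + 1) • (x : V), by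
        have := hmem (n + 1) x x.2
        rwa [hper] at this⟩
      map_zero' := Subtype.ext (smul_zero _)
      map_add' := fun x y => Subtype.ext (smul_add _ _ _) }
  have hS : Function.Bijective S := by
    refine ⟨(injective_iff_map_eq_zero S).2 fun x hx =>
      Subtype.ext (hinj x x.2 (congrArg Subtype.val hx)), fun x => ?_⟩
    obtain ⟨y, hy, h⟩ := hsurj x x.2
    exact ⟨⟨y, hy⟩, Subtype.ext h⟩
  let T : wt (m.ideal 0) ≃+ wt (m.ideal 0) := (AddEquiv.ofBijective S hS).symm
  have hYT : ∀ x : wt (m.ideal 0), 𝕐 ^ (n + 1) • (T x : V) = x := fun x =>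
    congrArg Subtype.val ((AddEquiv.ofBijective S hS).apply_symm_apply x)
  have hTY : ∀ x : wt (m.ideal 0), T (S x) = x :=
    (AddEquiv.ofBijective S hS).symm_apply_apply
  obtain ⟨Φ, hΦ⟩ := exists_hom_of_semilinear hσ m T fun r x y hy => by
    have h : y = S ⟨_, coeff_smul_mem (T x).2 ((σ ^ (n + 1)) r)⟩ := Subtype.ext (by
      change (y : V) = 𝕐 ^ (n + 1) • ρ ((σ ^ (n + 1)) r) • (T x : V)
      rw [← coeff_smul_Y_pow_smul, hYT, hy])
    rw [h, hTY]
  obtain ⟨f, hf, hiso⟩ := exists_linearEquiv_of_hom hσ hV m hne Φ (B := BandModuleM hσ t m)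
    (fun f => AddEquiv.refl _) (fun i => 𝕐 ^ (i : ℕ)) (pow_zero _) hinjm rfl
    (fun i => hmem i) (fun i x hx h => hinj x hx (by
      rw [← Nat.sub_add_cancel i.2.le, pow_add, mul_smul, h, smul_zero]))
    fun f x hf => by
      obtain ⟨θ, hθ, hθm, hθC, hθα⟩ := hΦ f x hf
      obtain ⟨F, hF⟩ := exists_bandModuleM_hom hσ θ hθC fun y => by
        have h := hθα ((((SkewLaurent.α (m.sigmaBar hσ))⁻¹ : (m.P hσ)ˣ) : m.P hσ) • y) (hθm _)
        rw [smul_smul, Units.mul_inv, one_smul] at h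
        rw [h, hYT]
      exact ⟨F, fun q => (hF _).trans (Finset.sum_congr rfl fun i _ =>
        congrArg (𝕐 ^ (i : ℕ) • ·) (hθ (q i)))⟩
  exact ⟨n, m, f, hf, Or.inl hiso⟩

/-- If `Xⁿ⁺¹` is bijective on `V_{m_0} ≠ 0`, where `n + 1` is the period of `m_0`, and `Xⁱ` maps
`V_{m_0}` into `V_{m_i}`, then `V ≅ N^f` for some irreducible `f`. -/
theorem isBandModule_of_X_pow (hV : IsWeightModule σ t V) (m : PeriodicChain σ n)
    (hne : IsWeight σ t V (m.ideal 0))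
    (hmem : ∀ (i : ℕ), ∀ x ∈ wt (m.ideal 0), 𝕏 ^ i • x ∈ wt (m.ideal i))
    (hinj : ∀ x ∈ wt (m.ideal 0), 𝕏 ^ (n + 1) • x = 0 → x = 0)
    (hsurj : ∀ x ∈ wt (m.ideal 0), ∃ y ∈ wt (m.ideal 0), 𝕏 ^ (n + 1) • y = x) :
    IsBandModule hσ t V := by
  have hinjm : Function.Injective fun i : Fin (n + 1) => m.ideal ((i : ℕ) : ℤ) := by
    have key : ∀ i j : ℕ, i < j → j < n + 1 → m.ideal (i : ℤ) ≠ m.ideal (j : ℤ) := by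
      intro i j hij hj h
      have := m.le_of_ideal_eq hσ (i := (i : ℤ)) (d := j - i) (by lia) (by
        rw [h]; congr 1; lia)
      lia
    intro i j h
    by_contra hne
    obtain hlt | hlt := lt_or_gt_of_ne (Fin.val_ne_of_ne hne)
    · exact key _ _ hlt j.2 h
    · exact key _ _ hlt i.2 h.symm
  let S : wt (m.ideal 0) →+ wt (m.ideal 0) :=
    { toFun := fun x => ⟨𝕏 ^ (n + 1) • (x : V), by
        have := hmem (n + 1) x x.2
        rwa [m.ideal_period] at this⟩
      map_zero' := Subtype.ext (smul_zero _)
      map_add' := fun x y => Subtype.ext (smul_add _ _ _) }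
  have hS : Function.Bijective S := by
    refine ⟨(injective_iff_map_eq_zero S).2 fun x hx =>
      Subtype.ext (hinj x x.2 (congrArg Subtype.val hx)), fun x => ?_⟩
    obtain ⟨y, hy, h⟩ := hsurj x x.2
    exact ⟨⟨y, hy⟩, Subtype.ext h⟩
  obtain ⟨Φ, hΦ⟩ := exists_hom_of_semilinear hσ m (AddEquiv.ofBijective S hS) fun r x y hy => by
    change 𝕏 ^ (n + 1) • (y : V) = ρ ((σ ^ (n + 1)) r) • 𝕏 ^ (n + 1) • (x : V)
    rw [hy, X_pow_smul_coeff_smul]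
  obtain ⟨f, hf, hiso⟩ := exists_linearEquiv_of_hom hσ hV m hne Φ (B := BandModuleN hσ t m)
    (fun f => AddEquiv.refl _) (fun i => 𝕏 ^ (i : ℕ)) (pow_zero _) hinjm rfl
    (fun i => hmem i) (fun i x hx h => hinj x hx (by
      rw [← Nat.sub_add_cancel i.2.le, pow_add, mul_smul, h, smul_zero]))
    fun f x hf => by
      obtain ⟨θ, hθ, hθm, hθC, hθα⟩ := hΦ f x hf
      obtain ⟨F, hF⟩ := exists_bandModuleN_hom hσ θ (fun i y _ => hmem i _ (hθm y)) hθC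
        fun y => (hθα y (hθm y)).symm
      exact ⟨F, fun q => (hF _).trans (Finset.sum_congr rfl fun i _ =>
        congrArg (𝕏 ^ (i : ℕ) • ·) (hθ (q i)))⟩
  exact ⟨n, m, f, hf, Or.inr hiso⟩

end Band

/-! ### Band modules with periodic weights -/

section Periodic

variable {R : Type u} [CommRing R] {σ : R →+* R} {t : R} (hσ : IsEssential σ)
variable {V : Type v} [AddCommGroup V] [Module (WGWA σ t) V] (hV : IsWeightModule σ t V)

local notation "ρ" => WGWA.coeff σ t
local notation "𝕏" => WGWA.X σ t
local notation "𝕐" => WGWA.Y σ t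
local notation "wt" => weightSpace σ t V

theorem comp_Y_pow_smul (hper : ∀ p, IsWeight σ t V p → p ∈ Function.periodicPts hσ.pull)
    {q : MaximalSpectrum R} (hq : q ∈ Function.periodicPts hσ.pull) (j : ℕ) (y : V) :
    comp hV (hσ.pull^[j] q) (𝕐 ^ j • y) = 𝕐 ^ j • comp hV q y := by
  induction y using weight_induction hV with
  | h0 => simp
  | hw p x hx =>
    by_cases hp : p = q
    · subst hp
      rw [comp_of_mem hV hx, comp_of_mem hV (Y_pow_smul_mem hσ hx j)]
    · rw [comp_of_mem_of_ne hV hx hp, smul_zero]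
      by_cases hx0 : x = 0
      · rw [hx0, smul_zero, map_zero]
      · exact comp_of_mem_of_ne hV (Y_pow_smul_mem hσ hx j)
          fun h => hp (hσ.pull_iterate_injOn (hper p ⟨x, hx, hx0⟩) hq h)
  | hadd x y hx hy => rw [smul_add, map_add, map_add, smul_add, hx, hy]

theorem X_pow_smul_mem (hV : IsWeightModule σ t V)
    (hper : ∀ p, IsWeight σ t V p → p ∈ Function.periodicPts hσ.pull)
    {q : MaximalSpectrum R} (hq : q ∈ Function.periodicPts hσ.pull) {j : ℕ} {x : V}
    (hx : x ∈ wt (hσ.pull^[j] q)) : 𝕏 ^ j • x ∈ wt q := by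
  have : 𝕏 ^ j • x = comp hV q (𝕏 ^ j • x) := eq_of_comp_eq hV fun p => by
    by_cases hp : p = q
    · subst hp
      rw [comp_of_mem hV (comp_mem hV _ _)]
    · rw [comp_of_mem_of_ne hV (comp_mem hV q _) (Ne.symm hp)]
      by_contra h
      exact hp (hσ.pull_iterate_injOn (hper p ⟨_, comp_mem hV p _, h⟩) hq
        (pull_iterate_eq_of_comp_X_pow hV hσ hx h))
  rw [this]
  exact comp_mem hV q _

theorem comp_X_pow_smul (hper : ∀ p, IsWeight σ t V p → p ∈ Function.periodicPts hσ.pull)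
    {q : MaximalSpectrum R} (hq : q ∈ Function.periodicPts hσ.pull) (j : ℕ) (y : V) :
    comp hV q (𝕏 ^ j • y) = 𝕏 ^ j • comp hV (hσ.pull^[j] q) y := by
  induction y using weight_induction hV with
  | h0 => simp
  | hw p x hx =>
    by_cases hp : p = hσ.pull^[j] q
    · subst hp
      rw [comp_of_mem hV hx, comp_of_mem hV (X_pow_smul_mem hσ hV hper hq hx)]
    · rw [comp_of_mem_of_ne hV hx hp, smul_zero]
      by_contra h
      exact hp (pull_iterate_eq_of_comp_X_pow hV hσ hx h).symm
  | hadd x y hx hy => rw [smul_add, map_add, map_add, smul_add, hx, hy]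

theorem exists_pow_smul_eq {a : WGWA σ t} (ha : ∀ x : V, ∃ y, a • y = x) (j : ℕ) (x : V) :
    ∃ y, a ^ j • y = x := by
  induction j with
  | zero => exact ⟨x, by simp⟩
  | succ j ih =>
    obtain ⟨y, rfl⟩ := ih
    obtain ⟨z, rfl⟩ := ha y
    exact ⟨z, by rw [pow_succ, mul_smul]⟩

theorem Y_pow_smul_ne_zero (hσ : IsEssential σ)
    (hinj : ∀ p, ∀ x ∈ wt p, 𝕐 • x = 0 → x = 0) {p : MaximalSpectrum R} {x : V} (hx : x ∈ wt p)
    (h0 : x ≠ 0) (j : ℕ) : 𝕐 ^ j • x ≠ 0 := by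
  induction j with
  | zero => simpa
  | succ j ih =>
    rw [pow_succ', mul_smul]
    exact fun h => ih (hinj _ _ (Y_pow_smul_mem hσ hx j) h)

variable [IsSimpleModule (WGWA σ t) V]

theorem exists_periodicChain (hV : IsWeightModule σ t V)
    (hper : ∀ p, IsWeight σ t V p → p ∈ Function.periodicPts hσ.pull) :
    ∃ (n : ℕ) (m : PeriodicChain σ n), IsWeight σ t V (m.ideal 0) ∧
      ∀ i, m.ideal i ∈ Function.periodicPts hσ.pull := by
  have : Nontrivial V := IsSimpleModule.nontrivial (WGWA σ t) V
  obtain ⟨q, hq⟩ := exists_isWeight hV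
  have hpos := Function.minimalPeriod_pos_of_mem_periodicPts (hper q hq)
  obtain ⟨n, hn⟩ : ∃ n, Function.minimalPeriod hσ.pull q = n + 1 :=
    Nat.exists_eq_succ_of_ne_zero hpos.ne'
  refine ⟨n, .ofPeriodic hσ q hn, by rwa [PeriodicChain.ofPeriodic_ideal_zero], fun i => ?_⟩
  exact (Function.bijOn_periodicPts hσ.pull).mapsTo.iterate _ (hper q hq)

/-- A simple weight module all of whose weights are periodic and on which `Y` is bijective is a
band module `M^f`. -/
theorem isBandModule_of_Y (hV : IsWeightModule σ t V)
    (hper : ∀ p, IsWeight σ t V p → p ∈ Function.periodicPts hσ.pull)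
    (hinj : ∀ p, ∀ x ∈ wt p, 𝕐 • x = 0 → x = 0) (hsurj : ∀ x : V, ∃ y, 𝕐 • y = x) :
    IsBandModule hσ t V := by
  obtain ⟨n, m, hne, hm⟩ := exists_periodicChain hσ hV hper
  have hiter : hσ.pull^[n + 1] (m.ideal 0) = m.ideal 0 := by
    rw [m.pull_iterate_ideal, ← m.periodic, sub_add_cancel]
  refine isBandModule_of_Y_pow hσ hV m hne (fun x hx h => ?_) fun x hx => ?_
  · by_contra h0
    exact Y_pow_smul_ne_zero hσ hinj hx h0 _ h
  · obtain ⟨y, hy⟩ := exists_pow_smul_eq hsurj (n + 1) x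
    refine ⟨comp hV (m.ideal 0) y, comp_mem hV _ _, ?_⟩
    rw [← comp_Y_pow_smul hσ hV hper (hm 0), hy, hiter, comp_of_mem hV hx]

/-- A simple weight module all of whose weights are periodic and on which `X` is bijective is a
band module `N^f`. -/
theorem isBandModule_of_X (hV : IsWeightModule σ t V)
    (hper : ∀ p, IsWeight σ t V p → p ∈ Function.periodicPts hσ.pull)
    (hinj : ∀ p, ∀ x ∈ wt p, 𝕏 • x = 0 → x = 0) (hsurj : ∀ x : V, ∃ y, 𝕏 • y = x) :
    IsBandModule hσ t V := by
  obtain ⟨n, m, hne, hm⟩ := exists_periodicChain hσ hV hper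
  have hiter : hσ.pull^[n + 1] (m.ideal 0) = m.ideal 0 := by
    rw [m.pull_iterate_ideal, ← m.periodic, sub_add_cancel]
  have hmem : ∀ (i : ℕ), ∀ x ∈ wt (m.ideal 0), 𝕏 ^ i • x ∈ wt (m.ideal i) := fun i x hx =>
    X_pow_smul_mem hσ hV hper (hm i) (by rwa [m.pull_iterate_ideal, sub_self])
  refine isBandModule_of_X_pow hσ hV m hne hmem (fun x hx h => ?_) fun x hx => ?_
  · have key : ∀ i : ℕ, 𝕏 ^ i • x = 0 → x = 0 := fun i => by
      induction i with
      | zero => simp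
      | succ i ih =>
        intro h
        rw [pow_succ', mul_smul] at h
        exact ih (hinj _ _ (hmem i x hx) h)
    exact key _ h
  · obtain ⟨y, hy⟩ := exists_pow_smul_eq hsurj (n + 1) x
    refine ⟨comp hV (m.ideal 0) y, comp_mem hV _ _, ?_⟩
    have := comp_X_pow_smul hσ hV hper (hm 0) (n + 1) y
    rw [hiter, hy, comp_of_mem hV hx] at this
    exact this.symm

end Periodic

/-! ### Recognition of string modules -/

section Strings

variable {R : Type u} [CommRing R] {σ : R →+* R} {t : R} (hσ : IsEssential σ)
variable {V : Type v} [AddCommGroup V] [Module (WGWA σ t) V]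

local notation "ρ" => WGWA.coeff σ t
local notation "𝕏" => WGWA.X σ t
local notation "𝕐" => WGWA.Y σ t
local notation "wt" => weightSpace σ t V

theorem coeff_smul_of {S : Set ℤ} (m : StringChain σ t S) (a : R) (i : S) (r : R) :
    ρ a • StringModule.of hσ m i (Ideal.Quotient.mk _ r) =
      StringModule.of hσ m i (Ideal.Quotient.mk _ (a * r)) :=
  (DFunLike.congr_fun (lift_coeff ..) _).trans (StringModule.opR_of hσ m a i r)

theorem X_smul_stringModule {S : Set ℤ} (m : StringChain σ t S) (w : StringModule hσ m) :
    𝕏 • w = StringModule.opX hσ m w :=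
  DFunLike.congr_fun (lift_X ..) _

theorem Y_smul_stringModule {S : Set ℤ} (m : StringChain σ t S) (w : StringModule hσ m) :
    𝕐 • w = StringModule.opY hσ m w :=
  DFunLike.congr_fun (lift_Y ..) _

/-- A simple module containing linearly independent weight vectors `x_i` on which `X` and `Y` act
as on the standard generators of a string module is isomorphic to that string module. The relation
`X x_i = σ(t) x_{i+1}` follows from `Y x_{i+1} = x_i`. -/
theorem nonempty_equiv_stringModule [IsSimpleModule (WGWA σ t) V] {S : Set ℤ} [Nonempty S]
    (m : StringChain σ t S) (x : S → V) (hx : ∀ i, x i ∈ wt (m.ideal i))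
    (hY : ∀ i j : S, (j : ℤ) = i + 1 → 𝕐 • x j = x i)
    (hY0 : ∀ i : S, (i : ℤ) - 1 ∉ S → 𝕐 • x i = 0) (hX0 : ∀ i : S, (i : ℤ) + 1 ∉ S → 𝕏 • x i = 0)
    (hne : ∀ i, x i ≠ 0)
    (hind : ∀ (I : Finset S) (r : S → R), ∑ i ∈ I, ρ (r i) • x i = 0 →
      ∀ i ∈ I, ρ (r i) • x i = 0) :
    Nonempty (V ≃ₗ[WGWA σ t] StringModule hσ m) := by
  classical
  let g : ∀ i : S, R ⧸ (m.ideal i).asIdeal →+ V := fun i =>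
    QuotientAddGroup.lift (m.ideal i).asIdeal.toAddSubgroup
      { toFun := fun r => ρ r • x i
        map_zero' := by rw [map_zero, zero_smul]
        map_add' := fun r s => by rw [map_add, add_smul] } (fun r hr => hx i r hr)
  have hg : ∀ i r, g i (Ideal.Quotient.mk _ r) = ρ r • x i := fun i r => rfl
  let F : StringModule hσ m →+ V := DirectSum.toAddMonoid g
  have hF : ∀ i r, F (StringModule.of hσ m i (Ideal.Quotient.mk _ r)) = ρ r • x i := fun i r => by
    rw [← hg]
    exact DirectSum.toAddMonoid_of g i _
  have hext : ∀ f f' : StringModule hσ m →+ V,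
      (∀ i r, f (StringModule.of hσ m i (Ideal.Quotient.mk _ r)) =
        f' (StringModule.of hσ m i (Ideal.Quotient.mk _ r))) → f = f' := fun f f' h => by
    refine DirectSum.addHom_ext fun i y => ?_
    obtain ⟨r, rfl⟩ := Ideal.Quotient.mk_surjective y
    exact h i r
  have hcomm : ∀ (a : WGWA σ t), (∀ i r, F (a • StringModule.of hσ m i (Ideal.Quotient.mk _ r)) =
      a • ρ r • x i) → ∀ w, F (a • w) = a • F w := fun a h w =>
    DFunLike.congr_fun (hext (F.comp (DistribSMul.toAddMonoidHom _ a))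
      ((DistribSMul.toAddMonoidHom _ a).comp F) fun i r => by
        change F (a • _) = a • F _
        rw [h, hF]) w
  let G : StringModule hσ m →ₗ[WGWA σ t] V := linearMapOf F
    (fun a => hcomm _ fun i r => by rw [coeff_smul_of, hF, coeff_mul_smul])
    (hcomm _ fun i r => by
      rw [X_smul_stringModule]
      by_cases h : (i : ℤ) + 1 ∈ S
      · rw [StringModule.opX_of hσ m i ⟨_, h⟩ rfl, hF, map_mul σ, mul_comm, coeff_mul_smul,
          ← X_smul_Y_smul, hY i ⟨_, h⟩ rfl, X_smul_coeff_smul]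
      · rw [StringModule.opX_of_end hσ m i h, map_zero, X_smul_coeff_smul, hX0 i h, smul_zero])
    (hcomm _ fun i r => by
      rw [Y_smul_stringModule]
      by_cases h : (i : ℤ) - 1 ∈ S
      · obtain ⟨s, hs⟩ := hσ.exists_sub_mem (m.ideal i) r
        rw [← Ideal.Quotient.eq.2 hs, StringModule.opY_of hσ m ⟨_, h⟩ i (by simp), hF,
          ← coeff_smul_congr (hx i) hs, ← coeff_smul_Y_smul, hY ⟨_, h⟩ i (by simp)]
      · obtain ⟨s, hs⟩ := hσ.exists_sub_mem (m.ideal i) r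
        rw [StringModule.opY_of_end hσ m i h, map_zero, ← coeff_smul_congr (hx i) hs,
          ← coeff_smul_Y_smul, hY0 i h, smul_zero])
  have hG : G ≠ 0 := fun h => by
    obtain ⟨i⟩ := ‹Nonempty S›
    have h1 : G (StringModule.of hσ m i (Ideal.Quotient.mk _ 1)) = 0 := by
      rw [h, LinearMap.zero_apply]
    exact hne i (by rw [← h1, ← one_smul (WGWA σ t) (x i), ← map_one (WGWA.coeff σ t), ← hF]; rfl)
  refine ⟨(LinearEquiv.ofBijective G ⟨(injective_iff_map_eq_zero G).2 fun w hw => ?_,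
    G.surjective_of_ne_zero hG⟩).symm⟩
  let w' : ⨁ i : S, R ⧸ (m.ideal i).asIdeal := w
  choose r hr using fun i => Ideal.Quotient.mk_surjective (w' i)
  have hsum : G w = ∑ i ∈ w'.support, ρ (r i) • x i := by
    have h1 := DirectSum.sum_support_of w'
    change F w' = _
    conv_lhs => rw [← h1]
    refine (map_sum F _ _).trans (Finset.sum_congr rfl fun i _ => ?_)
    rw [← hr, ← hg]
    exact DirectSum.toAddMonoid_of g i _
  refine DFinsupp.ext fun i => ?_
  by_contra hi
  have hi' : i ∈ w'.support := DFinsupp.mem_support_iff.2 hi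
  refine hi ?_
  change w' i = 0
  rw [← hr, Ideal.Quotient.eq_zero_iff_mem]
  exact (coeff_smul_eq_zero_iff (hx i) (hne i)).1 (hind _ r (hsum ▸ hw) i hi')

end Strings

/-! ### Linear independence along strings -/

section Independence

variable {R : Type u} [CommRing R] {σ : R →+* R} {t : R} (hσ : IsEssential σ)
variable {V : Type v} [AddCommGroup V] [Module (WGWA σ t) V]

local notation "ρ" => WGWA.coeff σ t
local notation "𝕏" => WGWA.X σ t
local notation "𝕐" => WGWA.Y σ t
local notation "wt" => weightSpace σ t V

/-- Independence of a sequence passes to families indexed through an injection into `ℕ`. -/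
theorem independent_of_injective {y : ℕ → V}
    (hy : ∀ (N : ℕ) (r : ℕ → R), ∑ j ∈ Finset.range N, ρ (r j) • y j = 0 →
      ∀ j < N, ρ (r j) • y j = 0)
    {ι : Type*} {k : ι → ℕ} (hk : Function.Injective k) (I : Finset ι) (r : ι → R)
    (h : ∑ i ∈ I, ρ (r i) • y (k i) = 0) : ∀ i ∈ I, ρ (r i) • y (k i) = 0 := by
  classical
  let r' : ℕ → R := Function.extend k (fun i => if i ∈ I then r i else 0) 0
  have hr' : ∀ i ∈ I, r' (k i) = r i := fun i hi => by
    change Function.extend _ _ _ _ = _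
    rw [hk.extend_apply, if_pos hi]
  obtain ⟨N, hN⟩ : ∃ N, ∀ i ∈ I, k i < N :=
    ⟨I.sup k + 1, fun i hi => Nat.lt_succ_of_le (Finset.le_sup hi)⟩
  have hsum : ∑ j ∈ Finset.range N, ρ (r' j) • y j = 0 := by
    rw [← h, ← Finset.sum_subset (s₁ := I.image k) (fun j hj => ?_) (fun j _ hj => ?_),
      Finset.sum_image hk.injOn]
    · exact Finset.sum_congr rfl fun i hi => by rw [hr' i hi]
    · obtain ⟨i, hi, rfl⟩ := Finset.mem_image.1 hj
      exact Finset.mem_range.2 (hN i hi)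
    · have : r' j = 0 := by
        change Function.extend _ _ _ _ = _
        by_cases hj' : ∃ i, k i = j
        · obtain ⟨i, rfl⟩ := hj'
          rw [hk.extend_apply, if_neg fun hi => hj (Finset.mem_image_of_mem k hi)]
        · rw [Function.extend_apply' _ _ _ hj']; rfl
      rw [this, map_zero, zero_smul]
  intro i hi
  rw [← hr' i hi]
  exact hy N r' hsum _ (hN i hi)

/-- If `X x = 0` and `X` kills none of the nonzero `Yʲ x`, `j ≥ 1`, then the nonzero `Yʲ x` are
independent: apply `X` to a relation. -/
theorem independent_Y_pow (hσ : IsEssential σ) {q : MaximalSpectrum R} {x : V} (hx : x ∈ wt q)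
    (hX : 𝕏 • x = 0)
    (hne : ∀ j : ℕ, 𝕐 ^ (j + 1) • x ≠ 0 → 𝕏 • 𝕐 ^ (j + 1) • x ≠ 0) (N : ℕ) (r : ℕ → R)
    (h : ∑ j ∈ Finset.range N, ρ (r j) • 𝕐 ^ j • x = 0) :
    ∀ j < N, ρ (r j) • 𝕐 ^ j • x = 0 := by
  induction N generalizing r with
  | zero => exact fun j hj => absurd hj (Nat.not_lt_zero j)
  | succ N ih =>
    rw [Finset.sum_range_succ'] at h
    have hpos : ∀ j < N, ρ (r (j + 1)) • 𝕐 ^ (j + 1) • x = 0 := fun j hj => by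
      have h1 := congrArg (𝕏 • ·) h
      simp only [smul_add, Finset.smul_sum, X_smul_coeff_smul, X_smul_Y_pow_succ_smul, pow_zero,
        one_smul, hX, smul_zero, add_zero, ← coeff_mul_smul] at h1
      have h2 := ih (fun j => σ (r (j + 1)) * σ t) h1 j hj
      simp only [coeff_mul_smul, ← X_smul_Y_pow_succ_smul] at h2
      by_contra h0
      have h3 : 𝕐 ^ (j + 1) • x ≠ 0 := fun h3 => h0 (by rw [h3, smul_zero])
      have h4 : 𝕏 • 𝕐 ^ (j + 1) • x ∈ wt (hσ.pull^[j] q) := by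
        rw [X_smul_Y_pow_succ_smul]
        exact coeff_smul_mem (Y_pow_smul_mem hσ hx j) _
      have h5 := (coeff_smul_eq_zero_iff h4 (hne j h3)).1 h2
      refine h0 (Y_pow_smul_mem hσ hx (j + 1) _ ?_)
      rwa [Function.iterate_succ_apply']
    rw [Finset.sum_eq_zero fun j hj => hpos j (Finset.mem_range.1 hj), zero_add] at h
    intro j hj
    cases j with
    | zero => exact h
    | succ j => exact hpos j (Nat.lt_of_succ_lt_succ hj)

/-- A sequence of nonzero weight vectors with `Y y_{j+1} = y_j` and `Y y_0 = 0` is independent: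
apply `Y` to a relation. -/
theorem independent_of_Y_smul_succ (hσ : IsEssential σ) {p : ℕ → MaximalSpectrum R} {y : ℕ → V}
    (hy : ∀ j, y j ∈ wt (p j)) (hne : ∀ j, y j ≠ 0) (hp : ∀ j, hσ.pull (p (j + 1)) = p j)
    (hY : ∀ j, 𝕐 • y (j + 1) = y j) (hY0 : 𝕐 • y 0 = 0) (N : ℕ) (r : ℕ → R)
    (h : ∑ j ∈ Finset.range N, ρ (r j) • y j = 0) : ∀ j < N, ρ (r j) • y j = 0 := by
  induction N generalizing r with
  | zero => exact fun j hj => absurd hj (Nat.not_lt_zero j)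
  | succ N ih =>
    choose s hs using fun j => exists_coeff_smul (V := V) (t := t) hσ (p j) (r j)
    rw [Finset.sum_range_succ'] at h
    have hpos : ∀ j < N, ρ (r (j + 1)) • y (j + 1) = 0 := fun j hj => by
      have h1 := congrArg (𝕐 • ·) h
      simp only [fun j => hs j _ (hy j), smul_add, Finset.smul_sum, ← coeff_smul_Y_smul, hY, hY0,
        smul_zero, add_zero] at h1
      have h2 := (coeff_smul_eq_zero_iff (hy j) (hne j)).1 (ih _ h1 j hj)
      rw [← hp j] at h2
      rw [hs _ _ (hy _)]
      exact hy _ _ h2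
    rw [Finset.sum_eq_zero fun j hj => hpos j (Finset.mem_range.1 hj), zero_add] at h
    intro j hj
    cases j with
    | zero => exact h
    | succ j => exact hpos j (Nat.lt_of_succ_lt_succ hj)

/-- Above a straight vector `x` with all `Y Xʲ⁺¹ x ≠ 0`, suitable multiples of the `Xʲ x` satisfy
`Y y_{j+1} = y_j`: as `t` is invertible on `Xʲ x`, one may divide by it. -/
theorem exists_sequence {x : V} (h0 : x ≠ 0) (hx : IsStraight σ t x)
    (hYX : ∀ j : ℕ, 𝕐 • 𝕏 ^ (j + 1) • x ≠ 0) :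
    ∃ (p : ℕ → MaximalSpectrum R) (y : ℕ → V), y 0 = x ∧ (∀ j, y j ∈ wt (p j)) ∧
      (∀ j, y j ≠ 0) ∧ ∀ j, 𝕐 • y (j + 1) = y j := by
  choose p hp using hx
  have ht : ∀ j, t ∉ (p j).asIdeal := fun j h => hYX j (by
    rw [Y_smul_X_pow_succ_smul]
    exact hp j t h)
  choose s hs using fun j => exists_mul_sub_one_mem (ht j)
  let y : ℕ → V := fun j => Nat.rec x (fun j z => 𝕏 • ρ (s j) • z) j
  have hsucc : ∀ j, y (j + 1) = 𝕏 • ρ (s j) • y j := fun j => rfl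
  have hform : ∀ j, ∃ c, y j = ρ c • 𝕏 ^ j • x := fun j => by
    induction j with
    | zero => exact ⟨1, by rw [map_one, one_smul, pow_zero, one_smul]; rfl⟩
    | succ j ih =>
      obtain ⟨c, hc⟩ := ih
      exact ⟨σ (s j * c), by rw [hsucc, hc, ← coeff_mul_smul, X_smul_coeff_smul, pow_succ',
        mul_smul]⟩
  have hy : ∀ j, y j ∈ wt (p j) := fun j => by
    obtain ⟨c, hc⟩ := hform j
    rw [hc]
    exact coeff_smul_mem (hp j) c
  have hY : ∀ j, 𝕐 • y (j + 1) = y j := fun j => by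
    rw [hsucc, Y_smul_X_smul, ← coeff_mul_smul, mul_comm, coeff_mul_smul,
      coeff_smul_coeff_smul_of_mul_sub_one_mem (hy j) (hs j)]
  refine ⟨p, y, rfl, hy, fun j => ?_, hY⟩
  induction j with
  | zero => exact h0
  | succ j ih => exact fun h => ih (by rw [← hY, h, smul_zero])

end Independence

/-! ### String modules inside simple weight modules -/

section Cases

variable {R : Type u} [CommRing R] {σ : R →+* R} {t : R} (hσ : IsEssential σ)
variable {V : Type v} [AddCommGroup V] [Module (WGWA σ t) V] [IsSimpleModule (WGWA σ t) V]

local notation "ρ" => WGWA.coeff σ t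
local notation "𝕏" => WGWA.X σ t
local notation "𝕐" => WGWA.Y σ t
local notation "wt" => weightSpace σ t V

/-- A vector `x` with `X x = 0` generates a string module with right end `M`, provided `X` kills
none of the nonzero `Yʲ x`, `j ≥ 1`. The index set is `S`; its left end, if any, is determined by
the vanishing of the vectors `Yʲ x`. -/
theorem exists_string_of_X_smul_eq_zero {q : MaximalSpectrum R} {x : V} (hx : x ∈ wt q)
    (hX : 𝕏 • x = 0) (hne : ∀ j : ℕ, 𝕐 ^ (j + 1) • x ≠ 0 → 𝕏 • 𝕐 ^ (j + 1) • x ≠ 0)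
    {S : Set ℤ} {M : ℤ} (hM : M ∈ S) (hle : ∀ i ∈ S, i ≤ M) (hend : ∀ i ∈ S, i + 1 ∉ S → i = M)
    (hS : ∀ i ∈ S, 𝕐 ^ (M - i).toNat • x ≠ 0)
    (hS0 : ∀ i ∈ S, i - 1 ∉ S → 𝕐 ^ ((M - i).toNat + 1) • x = 0) :
    ∃ m : StringChain σ t S, Nonempty (V ≃ₗ[WGWA σ t] StringModule hσ m) := by
  have : Nonempty S := ⟨⟨M, hM⟩⟩
  have hmem : ∀ j, 𝕐 ^ j • x ∈ wt (hσ.pull^[j] q) := fun j => Y_pow_smul_mem hσ hx j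
  let m : StringChain σ t S :=
    { ideal := fun i => hσ.pull^[(M - i).toNat] q
      step := fun i j h => by
        have hj := hle j j.2
        have : (M - i).toNat = (M - j).toNat + 1 := by lia
        rw [this, Function.iterate_succ_apply']
        exact le_rfl
      left_end := fun i hi => by
        rw [← coeff_smul_eq_zero_iff (hmem _) (hS i i.2), ← X_smul_Y_pow_succ_smul,
          hS0 i i.2 hi, smul_zero]
      right_end := fun i hi => by
        have hiM := hend i i.2 hi
        have h0 := hS i i.2
        rw [hiM, sub_self, Int.toNat_zero] at h0 ⊢
        rw [pow_zero, one_smul] at h0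
        rw [Function.iterate_zero_apply, ← coeff_smul_eq_zero_iff hx h0, ← Y_smul_X_smul, hX,
          smul_zero] }
  refine ⟨m, nonempty_equiv_stringModule hσ m (fun i => 𝕐 ^ (M - i).toNat • x)
    (fun i => hmem _) (fun i j h => ?_) (fun i hi => ?_) (fun i hi => ?_) (fun i => hS i i.2) ?_⟩
  · have hj := hle j j.2
    have : (M - i).toNat = (M - j).toNat + 1 := by lia
    rw [this, pow_succ', mul_smul]
  · rw [← mul_smul, ← pow_succ', hS0 i i.2 hi]
  · rw [hend i i.2 hi, sub_self, Int.toNat_zero, pow_zero, one_smul, hX]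
  · exact independent_of_injective (y := fun j => 𝕐 ^ j • x) (independent_Y_pow hσ hx hX hne)
      (k := fun i : S => (M - i).toNat) fun i j h => Subtype.ext (by
        have hi := hle i i.2
        have hj := hle j j.2
        have h : (M - i).toNat = (M - j).toNat := h
        lia)

/-- A sequence of nonzero weight vectors with `Y y_{j+1} = y_j` and `Y y_0 = 0` identifies `V` with
a right infinite string module. -/
theorem isRightInfiniteString {p : ℕ → MaximalSpectrum R} {y : ℕ → V}
    (hy : ∀ j, y j ∈ wt (p j)) (hne : ∀ j, y j ≠ 0) (hp : ∀ j, hσ.pull (p (j + 1)) = p j)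
    (hY : ∀ j, 𝕐 • y (j + 1) = y j) (hY0 : 𝕐 • y 0 = 0) : IsRightInfiniteString hσ t V := by
  have hend : ∀ i : Set.Ici (0 : ℤ), (i : ℤ) - 1 ∉ Set.Ici (0 : ℤ) → (i : ℤ) = 0 := fun i hi => by
    have h1 : (0 : ℤ) ≤ i := i.2
    have h2 : ¬ (0 : ℤ) ≤ i - 1 := hi
    lia
  have hsucc : ∀ i : Set.Ici (0 : ℤ), (i : ℤ) + 1 ∈ Set.Ici (0 : ℤ) := fun i => by
    have h1 : (0 : ℤ) ≤ i := i.2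
    exact Set.mem_Ici.2 (by lia)
  have htoNat : ∀ i j : Set.Ici (0 : ℤ), (j : ℤ) = i + 1 → (j : ℤ).toNat = (i : ℤ).toNat + 1 :=
    fun i j h => by
      have h1 : (0 : ℤ) ≤ i := i.2
      lia
  let m : StringChain σ t (Set.Ici 0) :=
    { ideal := fun i => p (i : ℤ).toNat
      step := fun i j h => by
        rw [htoNat i j h, ← hp (i : ℤ).toNat]
        exact le_rfl
      left_end := fun i hi => by
        rw [hend i hi, Int.toNat_zero, ← coeff_smul_eq_zero_iff (hy 0) (hne 0), ← X_smul_Y_smul,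
          hY0, smul_zero]
      right_end := fun i hi => absurd (hsucc i) hi }
  refine ⟨m, nonempty_equiv_stringModule hσ m (fun i => y (i : ℤ).toNat) (fun i => hy _)
    (fun i j h => ?_) (fun i hi => ?_) (fun i hi => absurd (hsucc i) hi) (fun i => hne _) ?_⟩
  · rw [htoNat i j h, hY]
  · rw [hend i hi, Int.toNat_zero, hY0]
  · exact independent_of_injective (independent_of_Y_smul_succ hσ hy hne hp hY hY0)
      (k := fun i : Set.Ici (0 : ℤ) => (i : ℤ).toNat) fun i j h => Subtype.ext (by
        have hi : (0 : ℤ) ≤ i := i.2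
        have hj : (0 : ℤ) ≤ j := j.2
        have h : (i : ℤ).toNat = (j : ℤ).toNat := h
        lia)

end Cases

/-! ### Band modules inside simple weight modules -/

section Bands

variable {R : Type u} [CommRing R] {σ : R →+* R} {t : R} (hσ : IsEssential σ)
variable {V : Type v} [AddCommGroup V] [Module (WGWA σ t) V] [IsSimpleModule (WGWA σ t) V]

local notation "ρ" => WGWA.coeff σ t
local notation "𝕏" => WGWA.X σ t
local notation "𝕐" => WGWA.Y σ t
local notation "wt" => weightSpace σ t V

/-- If all weights are periodic and some weight vector is not killed by any power of `Y`, then `Y`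
kills no nonzero weight vector: the vectors killed by a power of `Y` would form a proper
submodule. -/
theorem eq_zero_of_Y_smul_eq_zero (hV : IsWeightModule σ t V)
    (hper : ∀ p, IsWeight σ t V p → p ∈ Function.periodicPts hσ.pull)
    {q : MaximalSpectrum R} {x : V} (hx : x ∈ wt q) (hne : ∀ j : ℕ, 𝕐 ^ j • x ≠ 0)
    {p : MaximalSpectrum R} {z : V} (hz : z ∈ wt p) (h : 𝕐 • z = 0) : z = 0 := by
  by_contra hz0
  let H : Set V := {y | (∃ p, y ∈ wt p) ∧ ∃ j : ℕ, 𝕐 ^ j • y = 0}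
  have htop : AddSubgroup.closure H = ⊤ := by
    refine closure_eq_top (σ := σ) (t := t) ?_ ?_ ?_ ⟨z, ⟨⟨p, hz⟩, 1, by rwa [pow_one]⟩, hz0⟩
    · rintro r y ⟨⟨p, hp⟩, j, hj⟩
      obtain ⟨s, hs⟩ := exists_coeff_pow_smul (V := V) (t := t) hσ j p r
      exact AddSubgroup.subset_closure ⟨⟨p, coeff_smul_mem hp r⟩, j, by
        rw [hs y hp, ← coeff_smul_Y_pow_smul, hj, smul_zero]⟩
    · rintro y ⟨⟨p, hp⟩, j, hj⟩
      by_cases hy0 : y = 0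
      · rw [hy0, smul_zero]
        exact AddSubgroup.zero_mem _
      obtain ⟨p', hp', rfl⟩ := (Function.bijOn_periodicPts hσ.pull).surjOn (hper p ⟨y, hp, hy0⟩)
      obtain ⟨s, hs⟩ := exists_coeff_pow_smul (V := V) (t := t) hσ j (hσ.pull p') t
      refine AddSubgroup.subset_closure ⟨⟨p', ?_⟩, j + 1, ?_⟩
      · have := X_pow_smul_mem hσ hV hper hp' (j := 1) hp
        rwa [pow_one] at this
      · rw [pow_succ, mul_smul, Y_smul_X_smul, hs y hp, ← coeff_smul_Y_pow_smul, hj, smul_zero]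
    · rintro y ⟨⟨p, hp⟩, j, hj⟩
      exact AddSubgroup.subset_closure ⟨⟨_, Y_smul_mem hσ hp⟩, j, by
        rw [← mul_smul, ← pow_succ, pow_succ', mul_smul, hj, smul_zero]⟩
  have hnil : ∀ y ∈ AddSubgroup.closure (H ∩ {y | y ∈ wt q}), ∃ j : ℕ, 𝕐 ^ j • y = 0 :=
    fun y hy => by
    induction hy using AddSubgroup.closure_induction with
    | mem y hy => exact hy.1.2
    | zero => exact ⟨0, smul_zero _⟩
    | add y y' _ _ hy hy' =>
      obtain ⟨a, ha⟩ := hy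
      obtain ⟨b, hb⟩ := hy'
      exact ⟨a + b, by
        rw [smul_add, pow_add, mul_smul _ _ y', hb, smul_zero, add_zero, pow_mul_comm, mul_smul,
          ha, smul_zero]⟩
    | neg y _ hy =>
      obtain ⟨a, ha⟩ := hy
      exact ⟨a, by rw [smul_neg, ha, neg_zero]⟩
  obtain ⟨j, hj⟩ := hnil x (mem_closure_inter_of_top hV (fun y hy => hy.1) htop hx)
  exact hne j hj

/-- If `X` kills `Yⁱ x ≠ 0`, where `x` is a weight vector and `i ≥ 1`, then `V` is spanned by the
`Yʲ x` with `j ≥ i`. Expressing `x` through these shows that its weight is periodic and that no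
power of `Y` kills it. -/
theorem isBandModule_of_X_smul_Y_pow_smul_eq_zero (hV : IsWeightModule σ t V)
    {q : MaximalSpectrum R} {x : V} (hx : x ∈ wt q) {i : ℕ} (hi : 1 ≤ i)
    (h0 : 𝕐 ^ i • x ≠ 0) (h : 𝕏 • 𝕐 ^ i • x = 0) : IsBandModule hσ t V := by
  have hmem : ∀ j, 𝕐 ^ j • x ∈ wt (hσ.pull^[j] q) := fun j => Y_pow_smul_mem hσ hx j
  have hx0 : x ≠ 0 := fun hx0 => h0 (by rw [hx0, smul_zero])
  let H : Set V := {y | ∃ r, ∃ j, i ≤ j ∧ y = ρ r • 𝕐 ^ j • x}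
  have hw : ∀ y ∈ H, ∃ p, y ∈ wt p := by
    rintro y ⟨r, j, hj, rfl⟩
    exact ⟨_, coeff_smul_mem (hmem j) r⟩
  have htop : AddSubgroup.closure H = ⊤ := by
    refine closure_eq_top (σ := σ) (t := t) ?_ ?_ ?_
      ⟨_, ⟨1, i, le_rfl, by rw [map_one, one_smul]⟩, h0⟩
    · rintro a y ⟨r, j, hj, rfl⟩
      exact AddSubgroup.subset_closure ⟨a * r, j, hj, by rw [coeff_mul_smul]⟩
    · rintro y ⟨r, j, hj, rfl⟩
      rw [X_smul_coeff_smul]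
      obtain rfl | hlt := hj.eq_or_lt
      · rw [h, smul_zero]
        exact AddSubgroup.zero_mem _
      · obtain ⟨j, rfl⟩ : ∃ j', j = j' + 1 := Nat.exists_eq_succ_of_ne_zero (by lia)
        rw [X_smul_Y_pow_succ_smul, ← coeff_mul_smul]
        exact AddSubgroup.subset_closure ⟨_, j, by lia, rfl⟩
    · rintro y ⟨r, j, hj, rfl⟩
      obtain ⟨s, hs⟩ := exists_coeff_smul (V := V) (t := t) hσ (hσ.pull^[j] q) r
      rw [hs _ (hmem j), ← coeff_smul_Y_smul, ← mul_smul (WGWA.Y σ t), ← pow_succ']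
      exact AddSubgroup.subset_closure ⟨s, j + 1, by lia, rfl⟩
  have hweight : ∀ p, IsWeight σ t V p → ∃ j, 1 ≤ j ∧ p = hσ.pull^[j] q := by
    rintro p ⟨y, hy, hy0⟩
    obtain ⟨_, ⟨r, j, hj, rfl⟩, hp, hne⟩ := exists_mem_inter_of_top hV hw htop hy hy0
    exact ⟨j, hi.trans hj, eq_of_mem_of_mem hV hp (coeff_smul_mem (hmem j) r) hne⟩
  have hq : q ∈ Function.periodicPts hσ.pull := by
    obtain ⟨j, hj, hqj⟩ := hweight q ⟨x, hx, hx0⟩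
    exact Function.mk_mem_periodicPts hj hqj.symm
  have hper : ∀ p, IsWeight σ t V p → p ∈ Function.periodicPts hσ.pull := fun p hp => by
    obtain ⟨j, -, rfl⟩ := hweight p hp
    exact (Function.bijOn_periodicPts hσ.pull).mapsTo.iterate j hq
  have hne : ∀ j : ℕ, 𝕐 ^ j • x ≠ 0 := fun j => by
    induction j with
    | zero => simpa
    | succ j ih =>
      intro hj
      -- `Yʲ` kills all `Yˡ x` with `l ≥ 1`, which span `V`.
      refine ih ?_
      have hx' : x ∈ AddSubgroup.closure H := htop ▸ AddSubgroup.mem_top x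
      have hker : H ⊆ (DistribSMul.toAddMonoidHom V (WGWA.Y σ t ^ j)).ker := by
        rintro y ⟨r, l, hl, rfl⟩
        obtain ⟨l, rfl⟩ := Nat.exists_eq_add_of_le (hi.trans hl)
        obtain ⟨s, hs⟩ := exists_coeff_pow_smul (V := V) (t := t) hσ j (hσ.pull^[1 + l] q) r
        change 𝕐 ^ j • ρ r • 𝕐 ^ (1 + l) • x = 0
        rw [hs _ (hmem _), ← coeff_smul_Y_pow_smul, ← mul_smul (WGWA.Y σ t ^ j), ← pow_add,
          show j + (1 + l) = l + (j + 1) by ring, pow_add, mul_smul (WGWA.Y σ t ^ l), hj,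
          smul_zero, smul_zero]
      exact (AddSubgroup.closure_le _).2 hker hx'
  refine isBandModule_of_Y hσ hV hper
    (fun p z hz => eq_zero_of_Y_smul_eq_zero hσ hV hper hx hne hz) fun y => ?_
  have hrange : H ⊆ (DistribSMul.toAddMonoidHom V (WGWA.Y σ t)).range := by
    rintro y ⟨r, j, hj, rfl⟩
    obtain ⟨j, rfl⟩ := Nat.exists_eq_add_of_le' (hi.trans hj)
    exact ⟨ρ (σ r) • 𝕐 ^ j • x, by
      rw [pow_succ', mul_smul, coeff_smul_Y_smul]; rfl⟩
  exact (AddSubgroup.closure_le _).2 hrange (htop ▸ AddSubgroup.mem_top y)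

/-- If `X` is injective on weight vectors and `Y Xʲ w = 0` for a straight vector `w ≠ 0` and some
`j ≥ 1`, then `V` is spanned by the `Xˡ w` with `l ≥ j`, and hence, `X` being surjective, by those
with `l` arbitrarily large. So all weights are periodic. -/
theorem isBandModule_of_Y_smul_X_pow_smul_eq_zero (hV : IsWeightModule σ t V)
    (hinj : ∀ p, ∀ x ∈ wt p, 𝕏 • x = 0 → x = 0) {w : V} (hw : IsStraight σ t w) (hw0 : w ≠ 0)
    {j : ℕ} (hj : 1 ≤ j) (h : 𝕐 • 𝕏 ^ j • w = 0) : IsBandModule hσ t V := by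
  choose p hp using hw
  have hne : ∀ l, 𝕏 ^ l • w ≠ 0 := fun l => by
    induction l with
    | zero => simpa
    | succ l ih =>
      rw [pow_succ', mul_smul]
      exact fun h => ih (hinj _ _ (hp l) h)
  let H : ℕ → Set V := fun i => {y | ∃ r, ∃ l, i ≤ l ∧ y = ρ r • 𝕏 ^ l • w}
  have hHw : ∀ i, ∀ y ∈ H i, ∃ p, y ∈ wt p := by
    rintro i y ⟨r, l, hl, rfl⟩
    exact ⟨_, coeff_smul_mem (hp l) r⟩
  have htop : AddSubgroup.closure (H j) = ⊤ := by
    refine closure_eq_top (σ := σ) (t := t) ?_ ?_ ?_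
      ⟨_, ⟨1, j, le_rfl, by rw [map_one, one_smul]⟩, hne j⟩
    · rintro a y ⟨r, l, hl, rfl⟩
      exact AddSubgroup.subset_closure ⟨a * r, l, hl, by rw [coeff_mul_smul]⟩
    · rintro y ⟨r, l, hl, rfl⟩
      rw [X_smul_coeff_smul, ← mul_smul (WGWA.X σ t), ← pow_succ']
      exact AddSubgroup.subset_closure ⟨σ r, l + 1, by lia, rfl⟩
    · rintro y ⟨r, l, hl, rfl⟩
      obtain ⟨s, hs⟩ := exists_coeff_smul (V := V) (t := t) hσ (p l) r
      rw [hs _ (hp l), ← coeff_smul_Y_smul]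
      obtain rfl | hlt := hl.eq_or_lt
      · rw [h, smul_zero]
        exact AddSubgroup.zero_mem _
      · obtain ⟨l, rfl⟩ : ∃ l', l = l' + 1 := Nat.exists_eq_succ_of_ne_zero (by lia)
        rw [Y_smul_X_pow_succ_smul, ← coeff_mul_smul]
        exact AddSubgroup.subset_closure ⟨_, l, by lia, rfl⟩
  have hsurj : ∀ y : V, ∃ z, 𝕏 • z = y := fun y => by
    have hrange : H j ⊆ (DistribSMul.toAddMonoidHom V (WGWA.X σ t)).range := by
      rintro y ⟨r, l, hl, rfl⟩
      obtain ⟨l, rfl⟩ := Nat.exists_eq_add_of_le' (hj.trans hl)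
      obtain ⟨s, hs⟩ := exists_coeff_smul (V := V) (t := t) hσ (p (l + 1)) r
      exact ⟨ρ s • 𝕏 ^ l • w, by
        rw [hs _ (hp _), pow_succ', mul_smul, ← X_smul_coeff_smul]; rfl⟩
    exact (AddSubgroup.closure_le _).2 hrange (htop ▸ AddSubgroup.mem_top y)
  have htop' : ∀ i, AddSubgroup.closure (H i) = ⊤ := fun i => by
    induction i with
    | zero =>
      rw [eq_top_iff, ← htop]
      refine AddSubgroup.closure_mono ?_
      rintro y ⟨r, l, -, rfl⟩
      exact ⟨r, l, Nat.zero_le l, rfl⟩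
    | succ i ih =>
      rw [eq_top_iff]
      intro y _
      obtain ⟨z, rfl⟩ := hsurj y
      have hle : AddSubgroup.closure (H i) ≤ (AddSubgroup.closure (H (i + 1))).comap
          (DistribSMul.toAddMonoidHom V (WGWA.X σ t)) := by
        refine (AddSubgroup.closure_le _).2 ?_
        rintro y ⟨r, l, hl, rfl⟩
        refine AddSubgroup.subset_closure ⟨σ r, l + 1, by lia, ?_⟩
        change 𝕏 • ρ r • 𝕏 ^ l • w = _
        rw [X_smul_coeff_smul, ← mul_smul (WGWA.X σ t), ← pow_succ']
      rw [ih] at hle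
      exact hle (AddSubgroup.mem_top z)
  have hweight : ∀ i q, IsWeight σ t V q → ∃ l, i ≤ l ∧ q = p l := by
    rintro i q ⟨y, hy, hy0⟩
    obtain ⟨_, ⟨r, l, hl, rfl⟩, hq, hne⟩ := exists_mem_inter_of_top hV (hHw i) (htop' i) hy hy0
    exact ⟨l, hl, eq_of_mem_of_mem hV hq (coeff_smul_mem (hp l) r) hne⟩
  refine isBandModule_of_X hσ hV (fun q hq => ?_) hinj hsurj
  obtain ⟨a, -, ha⟩ := hweight 0 q hq
  obtain ⟨b, hab, hb⟩ := hweight (a + 1) q hq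
  obtain ⟨d, rfl⟩ := Nat.exists_eq_add_of_le' hab
  refine Function.mk_mem_periodicPts (n := d + 1) (Nat.succ_pos d) ?_
  have := pull_iterate_eq_of_comp_X_pow hV hσ (hp a) (q := p (d + (a + 1))) (j := d + 1) (by
    rw [← mul_smul, ← pow_add, show d + 1 + a = d + (a + 1) by ring, comp_of_mem hV (hp _)]
    exact hne _)
  rw [← ha, ← hb] at this
  exact this

/-- The doubly infinite case. Let `x_i`, `i ∈ ℤ`, be nonzero weight vectors with `Y x_{i+1} = x_i`,
and let `X` be injective on weight vectors. If the `x_i` are independent, they identify `V` with a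
string module. Applying powers of `X` to a relation between them shows that the weights of `x_i` are
periodic for large `i`, hence for all `i`. -/
theorem isDoublyInfiniteString_or_isBandModule (hV : IsWeightModule σ t V)
    (hinj : ∀ p, ∀ x ∈ wt p, 𝕏 • x = 0 → x = 0) {p : ℤ → MaximalSpectrum R} {x : ℤ → V}
    (hx : ∀ i, x i ∈ wt (p i)) (hne : ∀ i, x i ≠ 0) (hY : ∀ i, 𝕐 • x (i + 1) = x i) :
    IsDoublyInfiniteString hσ t V ∨ IsBandModule hσ t V := by
  have hp : ∀ i, hσ.pull (p (i + 1)) = p i := fun i =>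
    eq_of_mem_of_mem hV (Y_smul_mem hσ (hx (i + 1))) (by rw [hY]; exact hx i) (by
      rw [hY]; exact hne i)
  have hX : ∀ i, 𝕏 • x i = ρ (σ t) • x (i + 1) := fun i => by rw [← hY i, X_smul_Y_smul]
  by_cases hind : ∀ (I : Finset (Set.univ : Set ℤ)) (r : ↥(Set.univ : Set ℤ) → R),
      ∑ i ∈ I, ρ (r i) • x i = 0 → ∀ i ∈ I, ρ (r i) • x i = 0
  · let m : StringChain σ t Set.univ :=
      { ideal := fun i => p i
        step := fun i j h => by
          rw [h, ← hp i]
          exact le_rfl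
        left_end := fun i hi => absurd (Set.mem_univ _) hi
        right_end := fun i hi => absurd (Set.mem_univ _) hi }
    exact Or.inl ⟨m, nonempty_equiv_stringModule hσ m (fun i => x i) (fun i => hx i)
      (fun i j h => by rw [h, hY]) (fun i hi => absurd (Set.mem_univ _) hi)
      (fun i hi => absurd (Set.mem_univ _) hi) (fun i => hne i) hind⟩
  right
  have hXmem : ∀ i, ∀ z ∈ wt (p i), (∃ c, z = ρ c • x i) → ∀ M : ℕ,
      𝕏 ^ M • z ∈ wt (p (i + M)) ∧ (z ≠ 0 → 𝕏 ^ M • z ≠ 0) := fun i z hz ⟨c, hc⟩ M => by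
    have hform : ∀ M : ℕ, ∃ c, 𝕏 ^ M • z = ρ c • x (i + M) := fun M => by
      induction M with
      | zero => exact ⟨c, by simpa using hc⟩
      | succ M ih =>
        obtain ⟨c, hc⟩ := ih
        exact ⟨σ c * σ t, by
          rw [pow_succ', mul_smul, hc, X_smul_coeff_smul, hX, ← coeff_mul_smul, Nat.cast_succ,
            add_assoc]⟩
    have hmem : ∀ M : ℕ, 𝕏 ^ M • z ∈ wt (p (i + M)) := fun M => by
      obtain ⟨c, hc⟩ := hform M
      rw [hc]
      exact coeff_smul_mem (hx _) c
    refine ⟨hmem M, fun hz0 => ?_⟩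
    induction M with
    | zero => simpa
    | succ M ih =>
      rw [pow_succ', mul_smul]
      exact fun h => ih (hinj _ _ (hmem M) h)
  push Not at hind
  obtain ⟨I, r, hsum, b, hb, hb0⟩ := hind
  have hpit : ∀ (i : ℤ) (d : ℕ), hσ.pull^[d] (p (i + d)) = p i := fun i d => by
    induction d with
    | zero => simp
    | succ d ih =>
      rw [Function.iterate_succ_apply, Nat.cast_succ, ← add_assoc, hp, ih]
  -- In `X^M` applied to the relation, the term of `b` must cancel against one of equal weight.
  have hlarge : ∀ M : ℕ, p (b + M) ∈ Function.periodicPts hσ.pull := fun M => by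
    have hsum' : ∑ i ∈ I, 𝕏 ^ M • ρ (r i) • x i = 0 := by
      rw [← Finset.smul_sum, hsum, smul_zero]
    have hmem := fun i : (Set.univ : Set ℤ) =>
      hXmem i _ (coeff_smul_mem (hx i) (r i)) ⟨r i, rfl⟩ M
    obtain ⟨i, hiI, hib, hpi⟩ : ∃ i ∈ I, i ≠ b ∧ p (i + M) = p (b + M) := by
      by_contra! hc
      refine (hmem b).2 hb0 ?_
      have h := congrArg (comp hV (p (b + M))) hsum'
      rwa [map_sum, map_zero, Finset.sum_eq_single b
        (fun i hi hib => comp_of_mem_of_ne hV (hmem i).1 (hc i hi hib)) (fun h => absurd hb h),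
        comp_of_mem hV (hmem b).1] at h
    have hib' : (i : ℤ) ≠ b := fun h => hib (Subtype.ext h)
    obtain hlt | hlt := lt_or_gt_of_ne hib'
    · refine Function.mk_mem_periodicPts (n := ((b : ℤ) - i).toNat) (by lia) ?_
      have := hpit (i + M) ((b : ℤ) - i).toNat
      rwa [show (i : ℤ) + M + ((b : ℤ) - i).toNat = b + M by lia, hpi] at this
    · refine Function.mk_mem_periodicPts (n := ((i : ℤ) - b).toNat) (by lia) ?_
      have := hpit (b + M) ((i : ℤ) - b).toNat
      rwa [show (b : ℤ) + M + ((i : ℤ) - b).toNat = i + M by lia, hpi] at this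
  have hall : ∀ i, p i ∈ Function.periodicPts hσ.pull := fun i => by
    have h1 := (Function.bijOn_periodicPts hσ.pull).mapsTo.iterate ((b : ℤ) - i).toNat
      (hlarge (i - b).toNat)
    rw [show (b : ℤ) + (i - b).toNat = i + ((b : ℤ) - i).toNat by lia, hpit] at h1
    exact h1
  let H : Set V := {y | ∃ r i, y = ρ r • x i}
  have hHw : ∀ y ∈ H, ∃ p, y ∈ wt p := by
    rintro y ⟨r, i, rfl⟩
    exact ⟨_, coeff_smul_mem (hx i) r⟩
  have htop : AddSubgroup.closure H = ⊤ := by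
    refine closure_eq_top (σ := σ) (t := t) ?_ ?_ ?_
      ⟨_, ⟨1, 0, by rw [map_one, one_smul]⟩, hne 0⟩
    · rintro a y ⟨r, i, rfl⟩
      exact AddSubgroup.subset_closure ⟨a * r, i, by rw [coeff_mul_smul]⟩
    · rintro y ⟨r, i, rfl⟩
      rw [X_smul_coeff_smul, hX, ← coeff_mul_smul]
      exact AddSubgroup.subset_closure ⟨_, i + 1, rfl⟩
    · rintro y ⟨r, i, rfl⟩
      obtain ⟨s, hs⟩ := exists_coeff_smul (V := V) (t := t) hσ (p i) r
      obtain ⟨i, rfl⟩ : ∃ i', i = i' + 1 := ⟨i - 1, by ring⟩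
      rw [hs _ (hx _), ← coeff_smul_Y_smul, hY]
      exact AddSubgroup.subset_closure ⟨s, i, rfl⟩
  refine isBandModule_of_X hσ hV ?_ hinj fun y => ?_
  · rintro q ⟨y, hy, hy0⟩
    obtain ⟨_, ⟨r, i, rfl⟩, hq, hne⟩ := exists_mem_inter_of_top hV hHw htop hy hy0
    rw [eq_of_mem_of_mem hV hq (coeff_smul_mem (hx i) r) hne]
    exact hall i
  · have hrange : H ⊆ (DistribSMul.toAddMonoidHom V (WGWA.X σ t)).range := by
      rintro y ⟨r, i, rfl⟩
      obtain ⟨i, rfl⟩ : ∃ i', i = i' + 1 := ⟨i - 1, by ring⟩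
      -- As `X x_i ≠ 0`, the element `σ(t)` is invertible on `x_{i+1}`.
      have ht : σ t ∉ (p (i + 1)).asIdeal := fun h =>
        hne i (hinj _ _ (hx i) (by rw [hX]; exact hx _ _ h))
      obtain ⟨a, ha⟩ := exists_mul_sub_one_mem ht
      obtain ⟨s, hs⟩ := exists_coeff_smul (V := V) (t := t) hσ (p (i + 1)) (r * a)
      refine ⟨ρ s • x i, ?_⟩
      change 𝕏 • ρ s • x i = _
      rw [X_smul_coeff_smul, hX, ← hs _ (coeff_smul_mem (hx _) _), coeff_mul_smul,
        coeff_smul_coeff_smul_of_mul_sub_one_mem (hx _) ha]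
    exact (AddSubgroup.closure_le _).2 hrange (htop ▸ AddSubgroup.mem_top y)

/-- The case that `X` kills a nonzero weight vector `x`: either the vectors `Yʲ x` identify `V` with
a string module, or `X` kills some `Yⁱ x ≠ 0` with `i ≥ 1`. -/
theorem isStringModule_or_isBandModule_of_X_smul_eq_zero (hV : IsWeightModule σ t V)
    (h : ∃ q, ∃ x ∈ wt q, x ≠ 0 ∧ 𝕏 • x = 0) : IsStringModule hσ t V ∨ IsBandModule hσ t V := by
  classical
  obtain ⟨q, x, hx, hx0, hX⟩ := h
  by_cases hband : ∃ i : ℕ, 1 ≤ i ∧ 𝕐 ^ i • x ≠ 0 ∧ 𝕏 • 𝕐 ^ i • x = 0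
  · obtain ⟨i, hi, h0, h⟩ := hband
    exact Or.inr (isBandModule_of_X_smul_Y_pow_smul_eq_zero hσ hV hx hi h0 h)
  push Not at hband
  have hne : ∀ j : ℕ, 𝕐 ^ (j + 1) • x ≠ 0 → 𝕏 • 𝕐 ^ (j + 1) • x ≠ 0 :=
    fun j => hband (j + 1) (Nat.succ_pos j)
  left
  by_cases hinf : ∀ j : ℕ, 𝕐 ^ j • x ≠ 0
  · refine Or.inr (Or.inr (Or.inl ?_))
    refine exists_string_of_X_smul_eq_zero hσ hx hX hne (M := 0) (Set.mem_Iic.2 le_rfl)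
      (fun i hi => hi) (fun i hi hi' => ?_) (fun i _ => hinf _) fun i hi hi' => ?_
    · rw [Set.mem_Iic] at hi hi'
      lia
    · rw [Set.mem_Iic] at hi hi'
      lia
  · push Not at hinf
    obtain ⟨N, hN, hmin⟩ : ∃ N : ℕ, 𝕐 ^ N • x = 0 ∧ ∀ j < N, 𝕐 ^ j • x ≠ 0 :=
      ⟨Nat.find hinf, Nat.find_spec hinf, fun j hj => Nat.find_min hinf hj⟩
    obtain ⟨n, rfl⟩ : ∃ n, N = n + 1 := Nat.exists_eq_succ_of_ne_zero fun h0 => hx0 (by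
      rwa [h0, pow_zero, one_smul] at hN)
    refine Or.inl ⟨n, ?_⟩
    refine exists_string_of_X_smul_eq_zero hσ hx hX hne (M := n) ⟨by lia, le_rfl⟩
      (fun i hi => hi.2) (fun i hi hi' => ?_) (fun i hi => hmin _ ?_) fun i hi hi' => ?_
    · rw [Set.mem_Icc] at hi hi'
      lia
    · rw [Set.mem_Icc] at hi
      lia
    · rw [Set.mem_Icc] at hi hi'
      rwa [show ((n : ℤ) - i).toNat = n by lia]

/-- The case that `X` is injective on weight vectors. If `Y` kills a straight vector, this vector
starts a right infinite string, or gives rise to a band. Otherwise, the vectors `Yʲ v` and suitable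
multiples of the vectors `Xʲ v`, for a straight vector `v`, form a doubly infinite sequence. -/
theorem isStringModule_or_isBandModule_of_injective (hV : IsWeightModule σ t V)
    (hinj : ∀ p, ∀ x ∈ wt p, 𝕏 • x = 0 → x = 0) :
    IsStringModule hσ t V ∨ IsBandModule hσ t V := by
  by_cases hB : ∃ w : V, w ≠ 0 ∧ IsStraight σ t w ∧ 𝕐 • w = 0
  · obtain ⟨w, hw0, hw, hYw⟩ := hB
    by_cases hband : ∃ j : ℕ, 1 ≤ j ∧ 𝕐 • 𝕏 ^ j • w = 0
    · obtain ⟨j, hj, h⟩ := hband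
      exact Or.inr (isBandModule_of_Y_smul_X_pow_smul_eq_zero hσ hV hinj hw hw0 hj h)
    push Not at hband
    obtain ⟨p, y, rfl, hy, hne, hY⟩ := exists_sequence hw0 hw fun j => hband (j + 1) (by lia)
    refine Or.inl (Or.inr (Or.inl (isRightInfiniteString hσ hy hne (fun j => ?_) hY hYw)))
    exact eq_of_mem_of_mem hV (Y_smul_mem hσ (hy (j + 1))) (by rw [hY]; exact hy j) (by
      rw [hY]; exact hne j)
  push Not at hB
  obtain ⟨v, hv0, hv⟩ := exists_isStraight (V := V) hσ hV
  have hYne : ∀ j : ℕ, 𝕐 ^ j • v ≠ 0 := fun j => by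
    induction j with
    | zero => simpa
    | succ j ih =>
      rw [pow_succ', mul_smul]
      exact hB _ ih (hv.Y_pow hσ j)
  have hXne : ∀ j : ℕ, 𝕏 ^ j • v ≠ 0 := fun j => by
    induction j with
    | zero => simpa
    | succ j ih =>
      obtain ⟨p, hp⟩ := hv j
      rw [pow_succ', mul_smul]
      exact fun h => ih (hinj p _ hp h)
  obtain ⟨p, y, hy0, hy, hne, hY⟩ :=
    exists_sequence hv0 hv fun j => hB _ (hXne (j + 1)) (hv.X_pow (j + 1))
  let q : ℤ → MaximalSpectrum R
    | Int.ofNat j => p j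
    | Int.negSucc j => hσ.pull^[j + 1] (p 0)
  let x : ℤ → V
    | Int.ofNat j => y j
    | Int.negSucc j => 𝕐 ^ (j + 1) • v
  have hx : ∀ i, x i ∈ wt (q i)
    | Int.ofNat j => hy j
    | Int.negSucc j => Y_pow_smul_mem hσ (hy0 ▸ hy 0) (j + 1)
  have hxne : ∀ i, x i ≠ 0
    | Int.ofNat j => hne j
    | Int.negSucc j => hYne (j + 1)
  have hxY : ∀ i, 𝕐 • x (i + 1) = x i
    | Int.ofNat j => hY j
    | Int.negSucc 0 => by
      change 𝕐 • y 0 = 𝕐 ^ (0 + 1) • v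
      rw [hy0, zero_add, pow_one]
    | Int.negSucc (j + 1) => by
      change 𝕐 • 𝕐 ^ (j + 1) • v = 𝕐 ^ (j + 1 + 1) • v
      rw [pow_succ' _ (j + 1), mul_smul]
  obtain h | h := isDoublyInfiniteString_or_isBandModule hσ hV hinj hx hxne hxY
  · exact Or.inl (Or.inr (Or.inr (Or.inr h)))
  · exact Or.inr h

end Bands

end WGWA

/-! ### The classification -/

theorem theorem4p1 {R : Type u} [CommRing R] (σ : R →+* R) (t : R) (hσ : IsEssential σ)
    (V : Type v) [AddCommGroup V] [Module (WGWA σ t) V] [IsSimpleModule (WGWA σ t) V]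
    (hV : IsWeightModule σ t V) :
    IsStringModule hσ t V ∨ IsBandModule hσ t V := by
  by_cases hA : ∃ q, ∃ x ∈ weightSpace σ t V q, x ≠ 0 ∧ WGWA.X σ t • x = 0
  · exact WGWA.isStringModule_or_isBandModule_of_X_smul_eq_zero hσ hV hA
  push Not at hA
  have hinj : ∀ p, ∀ x ∈ weightSpace σ t V p, WGWA.X σ t • x = 0 → x = 0 := fun p x hx h => by
    by_contra hx0
    exact hA p x hx hx0 h
  exact WGWA.isStringModule_or_isBandModule_of_injective hσ hV hinj
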